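/- Let $L\ge 0$, $K\ge 1$, and let channel vectors $\mathbf h_k\in\mathbb C^L$, noise powers $\sigma_k^2>0$, weights $\delta_k\ge 0$ ($k=1,\dots,K$), a power budget $P_t>0$ and fixed auxiliary variables $\alpha_{0,k},\alpha_{k,k}\ge 0$, $\beta_{0,k},\beta_{k,k}\in\mathbb C$ be given. For a beamforming matrix $\mathbf W=[\mathbf w_0,\mathbf w_1,\dots,\mathbf w_K]\in\mathbb C^{L\times(K+1)}$ and $i\in\{0,k\}$ put $$g_{i,k}(\mathbf W)=2\sqrt{1+\alpha_{i,k}}\,\Re\{\beta_{i,k}^H\mathbf h_k^H\mathbf w_i\}-\alpha_{i,k}-|\beta_{i,k}|^2\Big(\sum_{j\in\{1,\dots,K\}\cup\{i\}}|\mathbf h_k^H\mathbf w_j|^2+\sigma_k^2\Big)+\log(1+\alpha_{i,k}),$$ let $\bar\delta=\max_k\delta_k$, and consider the convex problem $$\text{(P5)}\qquad \max_{\mathbf W,\,y\in\mathbb R}\ \bar\delta\, y+\sum_{k=1}^K\delta_k g_{k,k}(\mathbf W)\quad\text{s.t.}\quad y\le g_{0,k}(\mathbf W)\ \ \forall k,\qquad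 \mathrm{tr}(\mathbf W\mathbf W^H)\le P_t .$$ Assume that the power constraint is not redundant: some $(\mathbf W,y)$ with $y\le g_{0,k}(\mathbf W)$ for all $k$ (but of arbitrary power) has a strictly larger objective value than every feasible point of (P5). (Equivalently, the optimal multiplier $\mu^\star$ of the power constraint is positive.) For $\boldsymbol\lambda\in\mathcal H=\{\boldsymbol\lambda\in\mathbb R^K:\lambda_k\ge0,\ \sum_k\lambda_k=\bar\delta\}$ and $\mu>0$ let $\mathbf W(\boldsymbol\lambda,\mu)$ be the matrix with columns $$\mathbf w_0=\Big(\sum_j\lambda_j|\beta_{0,j}|^2\mathbf h_j\mathbf h_j^H+\mu\mathbf I\Big)^{-1}\sum_j\sqrt{1+\alpha_{0,j}}\,\beta_{0,j}\lambda_j\mathbf h_j,$$ $$\mathbf w_k=\sqrt{1+\alpha_{k,k}}\,\beta_{k,k}\delta_k\Big(\sum_j\big(\delta_j|\beta_{j,j}|^2+\lambda_j|\beta_{0,j}|^2\big)\mathbf h_j\mathbf h_j^H+\mu\mathbf I\Big)^{-1}\mathbf h_k ,$$ and put $h_{0,k}(\boldsymbol\lambda,\mu)=g_{0,k}(\mathbf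 W(\boldsymbol\lambda,\mu))$, $q(\boldsymbol\lambda,\mu)=\mathrm{tr}(\mathbf W(\boldsymbol\lambda,\mu)\mathbf W(\boldsymbol\lambda,\mu)^H)$. The hyperplane fixed-point iteration (HFPI) with constant $\rho\ge0$ started at $(\boldsymbol\lambda^{[0]},\mu^{[0]})$ is $$\lambda_k^{[t+1]}=\frac{h_{0,m}^{[t]}+\rho}{h_{0,k}^{[t]}+\rho}\lambda_k^{[t]}\ (k\ne m),\qquad \lambda_m^{[t+1]}=\lambda_m^{[t]}+\sum_{k=1}^K\Big(1-\frac{h_{0,m}^{[t]}+\rho}{h_{0,k}^{[t]}+\rho}\Big)\lambda_k^{[t]},\qquad \mu^{[t+1]}=\frac{q^{[t]}+\rho}{P_t+\rho}\mu^{[t]},$$ where $h_{0,k}^{[t]}=h_{0,k}(\boldsymbol\lambda^{[t]},\mu^{[t]})$, $q^{[t]}=q(\boldsymbol\lambda^{[t]},\mu^{[t]})$ and $m=m(t)$ is any index with $h_{0,m}^{[t]}=\min_k h_{0,k}^{[t]}$. Then (P5) has a unique optimal solution $(\mathbf W^\star,y^\star)$, and the set $\Lambda^\star$ of multipliers $(\boldsymbol\lambda,\mu)$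 which together with $(\mathbf W^\star,y^\star)$ satisfy the KKT conditions of (P5) is non-empty. Moreover, for every $\boldsymbol\lambda^{[0]}\in\mathcal H$ and every $\mu^{[0]}>0$ there is a finite $\rho_0\ge0$ such that for every $\rho\ge\rho_0$ and every choice of the indices $m(t)$ the HFPI stays well defined ($\boldsymbol\lambda^{[t]}\in\mathcal H$, $\mu^{[t]}>0$ and $h_{0,k}^{[t]}+\rho>0$ for all $t$ and $k$) and, as $t\to\infty$, the distance of $(\boldsymbol\lambda^{[t]},\mu^{[t]})$ to $\Lambda^\star$ tends to $0$, $\mathbf W(\boldsymbol\lambda^{[t]},\mu^{[t]})\to\mathbf W^\star$ and $h_{0,m(t)}^{[t]}\to y^\star$. -/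

import Mathlib

open scoped Matrix Topology

namespace RSMA

/-- Data of the convex beamforming subproblem of weighted sum-rate maximisation in 1-layer
rate-splitting multiple access, with `L` transmit antennas and `K` single-antenna users.
The suffixes `c` and `p` stand for the common stream (index pair `(0,k)`) and the private
stream (index pair `(k,k)`) at user `k`. -/
structure Problem (L K : ℕ) where
  /-- channel vectors: `h k` is the column vector whose conjugate transpose is the downlink
  channel of user `k` -/
  h : Fin K → Fin L → ℂ
  /-- noise powers `σ_k ^ 2` -/
  noise : Fin K → ℝ
  /-- user weights -/
  δ : Fin K → ℝ
  /-- transmit power budget -/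
  Pt : ℝ
  /-- fixed auxiliary variables of the Lagrangian dual transform -/
  αc : Fin K → ℝ
  αp : Fin K → ℝ
  /-- fixed auxiliary variables of the quadratic transform -/
  βc : Fin K → ℂ
  βp : Fin K → ℂ

/-- Beamforming matrices `[w_0, w_1, …, w_K]`: column `0` carries the common stream, column
`k.succ` the private stream of user `k`. -/
abbrev Beamformer (L K : ℕ) := Matrix (Fin L) (Fin (K + 1)) ℂ

namespace Problem

variable {L K : ℕ} (p : Problem L K)

/-- The complex gain `h_kᴴ w_j`. -/
noncomputable def gain (W : Beamformer L K) (k : Fin K) (j : Fin (K + 1)) : ℂ :=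
  star (p.h k) ⬝ᵥ W.col j

/-- The transformed common rate `g_{0,k}(W)`. -/
noncomputable def gc (k : Fin K) (W : Beamformer L K) : ℝ :=
  2 * √(1 + p.αc k) * (star (p.βc k) * p.gain W k 0).re - p.αc k
    - ‖p.βc k‖ ^ 2 * ((∑ j : Fin (K + 1), ‖p.gain W k j‖ ^ 2) + p.noise k)
    + Real.log (1 + p.αc k)

/-- The transformed private rate `g_{k,k}(W)`. -/
noncomputable def gp (k : Fin K) (W : Beamformer L K) : ℝ :=
  2 * √(1 + p.αp k) * (star (p.βp k) * p.gain W k k.succ).re - p.αp k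
    - ‖p.βp k‖ ^ 2 * ((∑ j : Fin K, ‖p.gain W k j.succ‖ ^ 2) + p.noise k)
    + Real.log (1 + p.αp k)

/-- The transmit power `tr(W Wᴴ)`. -/
noncomputable def power (W : Beamformer L K) : ℝ := (W * Wᴴ).trace.re

/-- The largest weight `max_k δ_k`. -/
noncomputable def δmax : ℝ := ⨆ k, p.δ k

/-- The objective `max_k δ_k · y + ∑_k δ_k g_{k,k}(W)`. -/
noncomputable def objective (W : Beamformer L K) (y : ℝ) : ℝ :=
  p.δmax * y + ∑ k, p.δ k * p.gp k W

/-- The common-rate constraints `y ≤ g_{0,k}(W)` for all users. -/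
def RateFeasible (W : Beamformer L K) (y : ℝ) : Prop := ∀ k, y ≤ p.gc k W

/-- The feasible points of the subproblem. -/
def Feasible (W : Beamformer L K) (y : ℝ) : Prop :=
  p.RateFeasible W y ∧ power W ≤ p.Pt

/-- The optimal solutions of the subproblem. -/
def IsOptimal (W : Beamformer L K) (y : ℝ) : Prop :=
  p.Feasible W y ∧ ∀ W' y', p.Feasible W' y' → p.objective W' y' ≤ p.objective W y

/-- The power budget is a real restriction: without it a strictly larger objective value than
all values within the budget can be reached. -/
def PowerBinding : Prop :=
  ∃ W y, p.RateFeasible W y ∧ ∀ W' y', p.Feasible W' y' → p.objective W' y' < p.objective W y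

/-- The channel matrix `H = [h_1, …, h_K]`. -/
def H : Matrix (Fin L) (Fin K) ℂ := Matrix.of fun l k => p.h k l

/-- `θ_{0,j} = λ_j |β_{0,j}|²` -/
noncomputable def θc (lam : Fin K → ℝ) (j : Fin K) : ℝ := lam j * ‖p.βc j‖ ^ 2

/-- `θ_{j,j} = δ_j |β_{j,j}|² + λ_j |β_{0,j}|²` -/
noncomputable def θp (lam : Fin K → ℝ) (j : Fin K) : ℝ :=
  p.δ j * ‖p.βp j‖ ^ 2 + lam j * ‖p.βc j‖ ^ 2

/-- `d_{0,j} = √(1 + α_{0,j}) β_{0,j} λ_j` -/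
noncomputable def dc (lam : Fin K → ℝ) (j : Fin K) : ℂ :=
  (√(1 + p.αc j) : ℂ) * p.βc j * (lam j : ℂ)

/-- `d_{k,k} = √(1 + α_{k,k}) β_{k,k} δ_k` -/
noncomputable def dp (k : Fin K) : ℂ := (√(1 + p.αp k) : ℂ) * p.βp k * (p.δ k : ℂ)

/-- `H Θ_c(λ) Hᴴ + μ I` -/
noncomputable def Mc (lam : Fin K → ℝ) (mu : ℝ) : Matrix (Fin L) (Fin L) ℂ :=
  p.H * Matrix.diagonal (fun j => (p.θc lam j : ℂ)) * p.Hᴴ + (mu : ℂ) • 1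

/-- `H Θ_p(λ) Hᴴ + μ I` -/
noncomputable def Mp (lam : Fin K → ℝ) (mu : ℝ) : Matrix (Fin L) (Fin L) ℂ :=
  p.H * Matrix.diagonal (fun j => (p.θp lam j : ℂ)) * p.Hᴴ + (mu : ℂ) • 1

/-- The beamforming matrix `W(λ, μ)` determined by the dual variables:
`w_0 = (H Θ_c Hᴴ + μ I)⁻¹ H d_c` and `w_k = d_{k,k} (H Θ_p Hᴴ + μ I)⁻¹ h_k`. -/
noncomputable def beam (lam : Fin K → ℝ) (mu : ℝ) : Beamformer L K :=
  Matrix.of fun l j =>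
    (Fin.cons ((p.Mc lam mu)⁻¹ *ᵥ (p.H *ᵥ p.dc lam))
      (fun k => p.dp k • ((p.Mp lam mu)⁻¹ *ᵥ p.h k)) : Fin (K + 1) → Fin L → ℂ) j l

/-- The Karush-Kuhn-Tucker conditions of the subproblem: stationarity in `w_0`, in the `w_k`
and in `y`, complementary slackness, primal and dual feasibility. -/
structure IsKKT (W : Beamformer L K) (y : ℝ) (lam : Fin K → ℝ) (mu : ℝ) : Prop where
  stat_common : p.Mc lam mu *ᵥ W.col 0 = p.H *ᵥ p.dc lam
  stat_private : ∀ k : Fin K, p.Mp lam mu *ᵥ W.col k.succ = p.dp k • p.h k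
  stat_y : p.δmax = ∑ k, lam k
  slack_rate : ∀ k, lam k * (y - p.gc k W) = 0
  slack_power : mu * (power W - p.Pt) = 0
  primal : p.Feasible W y
  lam_nonneg : ∀ k, 0 ≤ lam k
  mu_nonneg : 0 ≤ mu

/-- The hyperplane `{λ ≥ 0 : ∑_k λ_k = max_k δ_k}`. -/
def hyperplane : Set (Fin K → ℝ) := {lam | (∀ k, 0 ≤ lam k) ∧ ∑ k, lam k = p.δmax}

/-- `h_{0,k}(λ, μ) = g_{0,k}(W(λ, μ))` -/
noncomputable def rate (lam : Fin K → ℝ) (mu : ℝ) (k : Fin K) : ℝ := p.gc k (p.beam lam mu)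

/-- The factor `(h_{0,m} + ρ) / (h_{0,k} + ρ)` at the dual variables `(λ, μ)`. -/
noncomputable def ratio (ρ : ℝ) (m : Fin K) (lam : Fin K → ℝ) (mu : ℝ) (k : Fin K) : ℝ :=
  (p.rate lam mu m + ρ) / (p.rate lam mu k + ρ)

/-- The update of `λ` when user `m` has the worst common rate. -/
noncomputable def nextLam (ρ : ℝ) (m : Fin K) (lam : Fin K → ℝ) (mu : ℝ) : Fin K → ℝ := fun k =>
  if k = m then lam m + ∑ i, (1 - p.ratio ρ m lam mu i) * lam i
  else p.ratio ρ m lam mu k * lam k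

/-- The update of `μ`. -/
noncomputable def nextMu (ρ : ℝ) (lam : Fin K → ℝ) (mu : ℝ) : ℝ :=
  (power (p.beam lam mu) + ρ) / (p.Pt + ρ) * mu

/-- `(lam, mu)` is a run of the hyperplane fixed-point iteration with constant `ρ`; `m t` is the
user with the worst common rate in iteration `t` (any such user, if there are several). -/
structure IsHFPI (ρ : ℝ) (lam : ℕ → Fin K → ℝ) (mu : ℕ → ℝ) (m : ℕ → Fin K) : Prop where
  worst : ∀ t k, p.rate (lam t) (mu t) (m t) ≤ p.rate (lam t) (mu t) k
  lam_succ : ∀ t, lam (t + 1) = p.nextLam ρ (m t) (lam t) (mu t)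
  mu_succ : ∀ t, mu (t + 1) = p.nextMu ρ (lam t) (mu t)

end Problem

end RSMA

/-! For `mu > 0` the Lagrangian is a strongly concave quadratic in the beamformer, maximised by
`beam lam mu`, and it falls off from there with modulus `mu`. The dual function `val` is a supremum
of functions affine in the multipliers, hence convex; its derivative consists of the rates and the
power, and is Lipschitz as long as `mu` stays above some `a > 0`. The iteration is a scaled descent
method for `val`: a step has slope `-decr` (`slope_step`), while its squared length is `O(decr / ρ)`
(`dev_sq_le_decr`). For large `ρ` the descent lemma therefore gives a decrease of at least `decr /
2` (`val_step_le`).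

The difficulty is that the Lipschitz constant depends on `a`, so a lower bound for `mu` along the
run is needed before `ρ` is chosen. Let `ε` be half of some gain in objective value obtained by
ignoring the power budget. Where the dual gap is at most `ε`, weak duality at the power-violating
point keeps `mu` away from zero (`Exceeds.le_mu`). While the gap is at least `ε`, the entropy `mu -
ms * log mu` grows by at most a multiple of `decr` that does not depend on `ρ` (`barrier_step_le`);
the decrease of `val` pays for this growth, and the entropy blows up at zero. `exists_run_bounds`
combines both regimes.

Consequently `decr` tends to zero, and it controls the dual gap (`gap_le_sqrt`). Quadratic growth
turns convergence of `val` into convergence of the beamformers, and compactness into convergence to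
the set of multipliers. Multipliers exist because `val` attains its minimum on a suitable compact
box (`DualModel.exists_isSaddle`). -/

/-- Lagrangian model of the maximisation of `F W + c * min_k G k W` under `‖W‖ ^ 2 ≤ P`: for
multipliers `lam` of the rate constraints and `mu` of the power constraint, `sol lam mu` is the
maximiser of the Lagrangian, with quadratic growth of modulus `mu`. -/
structure DualModel (ι E : Type*) [Fintype ι] [NormedAddCommGroup E] where
  F : E → ℝ
  G : ι → E → ℝ
  c : ℝ
  P : ℝ
  sol : (ι → ℝ) → ℝ → E
  c_nonneg : 0 ≤ c
  P_pos : 0 < P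
  bound : ∃ B, (∀ W, F W ≤ B) ∧ ∀ k W, G k W ≤ B
  lip : ∀ R : ℝ, ∃ C : ℝ, 0 ≤ C ∧ ∀ k W W', ‖W‖ ≤ R → ‖W'‖ ≤ R →
    |G k W' - G k W| ≤ C * ‖W' - W‖
  growth : ∀ lam mu, (∀ k, 0 ≤ lam k) → 0 < mu → ∀ W,
    F W + ∑ k, lam k * G k W - mu * (‖W‖ ^ 2 - P) + mu * ‖W - sol lam mu‖ ^ 2 ≤
      F (sol lam mu) + ∑ k, lam k * G k (sol lam mu) - mu * (‖sol lam mu‖ ^ 2 - P)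

/-! ### Convexity and smoothness of the dual function. -/

namespace DualModel

variable {ι E : Type*} [Fintype ι] [NormedAddCommGroup E] (d : DualModel ι E)

/-- The Lagrangian on the hyperplane `∑ k, lam k = c`. -/
def lag (W : E) (lam : ι → ℝ) (mu : ℝ) : ℝ :=
  d.F W + ∑ k, lam k * d.G k W - mu * (‖W‖ ^ 2 - d.P)

/-- The multipliers of the rate constraints. -/
def simplex : Set (ι → ℝ) := {lam | (∀ k, 0 ≤ lam k) ∧ ∑ k, lam k = d.c}

/-- The dual function. -/
def val (lam : ι → ℝ) (mu : ℝ) : ℝ := d.lag (d.sol lam mu) lam mu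

def rate (lam : ι → ℝ) (mu : ℝ) (k : ι) : ℝ := d.G k (d.sol lam mu)

def pw (lam : ι → ℝ) (mu : ℝ) : ℝ := ‖d.sol lam mu‖ ^ 2

/-- The derivative of the dual function at `(lam, mu)` in the direction of `(lam', mu')`. -/
def slope (lam : ι → ℝ) (mu : ℝ) (lam' : ι → ℝ) (mu' : ℝ) : ℝ :=
  ∑ k, d.rate lam mu k * (lam' k - lam k) - (d.pw lam mu - d.P) * (mu' - mu)

/-- The `ℓ¹` distance of two pairs of multipliers. -/
def dev (lam : ι → ℝ) (mu : ℝ) (lam' : ι → ℝ) (mu' : ℝ) : ℝ :=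
  ∑ k, |lam' k - lam k| + |mu' - mu|

theorem dev_nonneg (lam : ι → ℝ) (mu : ℝ) (lam' : ι → ℝ) (mu' : ℝ) :
    0 ≤ dev lam mu lam' mu' :=
  add_nonneg (Finset.sum_nonneg fun _ _ => abs_nonneg _) (abs_nonneg _)

theorem lag_sub (W : E) (lam : ι → ℝ) (mu : ℝ) (lam' : ι → ℝ) (mu' : ℝ) :
    d.lag W lam' mu' - d.lag W lam mu =
      ∑ k, d.G k W * (lam' k - lam k) - (‖W‖ ^ 2 - d.P) * (mu' - mu) := by
  have : ∑ k, d.G k W * (lam' k - lam k) = ∑ k, lam' k * d.G k W - ∑ k, lam k * d.G k W := by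
    rw [← Finset.sum_sub_distrib]
    exact Finset.sum_congr rfl fun k _ => by ring
  rw [this, lag, lag]
  ring

variable {d} {lam lam' : ι → ℝ} {mu mu' : ℝ}

theorem lag_add_le_val (hl : lam ∈ d.simplex) (hm : 0 < mu) (W : E) :
    d.lag W lam mu + mu * ‖W - d.sol lam mu‖ ^ 2 ≤ d.val lam mu :=
  d.growth lam mu hl.1 hm W

theorem lag_le_val (hl : lam ∈ d.simplex) (hm : 0 < mu) (W : E) :
    d.lag W lam mu ≤ d.val lam mu := by
  have := lag_add_le_val hl hm W
  have : 0 ≤ mu * ‖W - d.sol lam mu‖ ^ 2 := by positivity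
  linarith

/-- At a fixed point `lag` is affine in the multipliers, so the maximiser for `(lam, mu)` supplies a
supporting affine function of the supremum `val`. No differentiation is needed. -/
theorem val_add_slope_le (hl' : lam' ∈ d.simplex) (hm' : 0 < mu') :
    d.val lam mu + d.slope lam mu lam' mu' ≤ d.val lam' mu' := by
  have h1 := lag_le_val hl' hm' (d.sol lam mu)
  have h2 := d.lag_sub (d.sol lam mu) lam mu lam' mu'
  simp only [val, slope, rate, pw] at *
  linarith

variable (d)

/-- The origin uses no power, so `val` grows at least like `mu * P`. This bounds `mu` on sublevel
sets of `val`. -/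
theorem exists_lag_zero_ge : ∃ A, ∀ lam ∈ d.simplex, ∀ mu, A + mu * d.P ≤ d.lag 0 lam mu := by
  refine ⟨d.F 0 - d.c * ∑ k, |d.G k 0|, fun lam hl mu => ?_⟩
  have h : -(d.c * ∑ k, |d.G k 0|) ≤ ∑ k, lam k * d.G k 0 := by
    rw [Finset.mul_sum, ← Finset.sum_neg_distrib]
    refine Finset.sum_le_sum fun k _ => ?_
    have h1 : lam k ≤ d.c := by
      rw [← hl.2]
      exact Finset.single_le_sum (fun i _ => hl.1 i) (Finset.mem_univ k)
    have h2 := neg_abs_le (d.G k 0)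
    have h3 := hl.1 k
    nlinarith [abs_nonneg (d.G k 0)]
  simp only [lag, norm_zero]
  linarith

/-- Comparing the maximiser with the origin cancels `mu * P`, so the bound is uniform down to `mu =
0`, where the maximisers themselves may be unbounded. -/
theorem exists_mul_sq_le : ∃ C, 0 ≤ C ∧ ∀ lam ∈ d.simplex, ∀ mu, 0 < mu →
    mu * ‖d.sol lam mu‖ ^ 2 ≤ C := by
  obtain ⟨A, hA⟩ := d.exists_lag_zero_ge
  obtain ⟨B, hF, hG⟩ := d.bound
  refine ⟨|B + d.c * B - A|, abs_nonneg _, fun lam hl mu hm => ?_⟩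
  have h1 := lag_le_val hl hm 0
  have h2 := hA lam hl mu
  have h3 : ∑ k, lam k * d.G k (d.sol lam mu) ≤ d.c * B := by
    rw [← hl.2, Finset.sum_mul]
    exact Finset.sum_le_sum fun k _ => mul_le_mul_of_nonneg_left (hG k _) (hl.1 k)
  have h4 := hF (d.sol lam mu)
  have h5 := le_abs_self (B + d.c * B - A)
  simp only [val, lag] at *
  linarith

theorem exists_norm_sol_le {a : ℝ} (ha : 0 < a) : ∃ R, 0 ≤ R ∧ ∀ lam ∈ d.simplex, ∀ mu, a ≤ mu →
    ‖d.sol lam mu‖ ≤ R := by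
  obtain ⟨C, hC, h⟩ := d.exists_mul_sq_le
  refine ⟨√(C / a), Real.sqrt_nonneg _, fun lam hl mu hm => Real.le_sqrt_of_sq_le ?_⟩
  rw [le_div_iff₀ ha]
  have := h lam hl mu (ha.trans_le hm)
  nlinarith [sq_nonneg ‖d.sol lam mu‖]

/-- Adding the growth inequalities of two maximisers, each tested at the other, bounds `(mu + mu') *
‖W' - W‖ ^ 2` by `‖W' - W‖` times the distance of the multipliers. Rates and power inherit the
Lipschitz bound. -/
theorem exists_lipschitz {a : ℝ} (ha : 0 < a) : ∃ Λ, 0 ≤ Λ ∧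
    ∀ lam ∈ d.simplex, ∀ mu, a ≤ mu → ∀ lam' ∈ d.simplex, ∀ mu', a ≤ mu' →
      (∀ k, |d.rate lam' mu' k - d.rate lam mu k| ≤ Λ * dev lam mu lam' mu') ∧
      |d.pw lam' mu' - d.pw lam mu| ≤ Λ * dev lam mu lam' mu' := by
  obtain ⟨R, hR, hsol⟩ := d.exists_norm_sol_le ha
  obtain ⟨C, hC, hlip⟩ := d.lip R
  refine ⟨(C + 2 * R) * ((C + 2 * R) / (2 * a)), by positivity,
    fun lam hl mu hm lam' hl' mu' hm' => ?_⟩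
  set W := d.sol lam mu with hW
  set W' := d.sol lam' mu' with hW'
  set D := dev lam mu lam' mu' with hD
  have hD0 : 0 ≤ D := dev_nonneg _ _ _ _
  have hWR : ‖W‖ ≤ R := hsol lam hl mu hm
  have hWR' : ‖W'‖ ≤ R := hsol lam' hl' mu' hm'
  have hG : ∀ k, |d.G k W' - d.G k W| ≤ C * ‖W' - W‖ := fun k => hlip k W W' hWR hWR'
  have hN : |‖W'‖ ^ 2 - ‖W‖ ^ 2| ≤ 2 * R * ‖W' - W‖ := by
    have h1 := abs_norm_sub_norm_le W' W
    rw [sq_sub_sq, abs_mul, abs_of_nonneg (by positivity)]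
    exact mul_le_mul (by linarith) h1 (abs_nonneg _) (by positivity)
  have hdist : ‖W' - W‖ ≤ (C + 2 * R) / (2 * a) * D := by
    have h1 := lag_add_le_val hl (ha.trans_le hm) W'
    have h2 := lag_add_le_val hl' (ha.trans_le hm') W
    have h3 := d.lag_sub W lam mu lam' mu'
    have h4 := d.lag_sub W' lam mu lam' mu'
    rw [← hW] at h1
    rw [← hW', norm_sub_rev] at h2
    have h5 : ∑ k, (d.G k W' - d.G k W) * (lam' k - lam k)
        - (‖W'‖ ^ 2 - ‖W‖ ^ 2) * (mu' - mu) ≤ (C + 2 * R) * ‖W' - W‖ * D := by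
      have e1 : ∑ k, (d.G k W' - d.G k W) * (lam' k - lam k) ≤
          C * ‖W' - W‖ * ∑ k, |lam' k - lam k| := by
        rw [Finset.mul_sum]
        refine Finset.sum_le_sum fun k _ => (le_abs_self _).trans ?_
        rw [abs_mul]
        exact mul_le_mul_of_nonneg_right (hG k) (abs_nonneg _)
      have e2 : -((‖W'‖ ^ 2 - ‖W‖ ^ 2) * (mu' - mu)) ≤ 2 * R * ‖W' - W‖ * |mu' - mu| := by
        refine (neg_le_abs _).trans ?_
        rw [abs_mul]
        exact mul_le_mul_of_nonneg_right hN (abs_nonneg _)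
      have e3 : 0 ≤ C * ‖W' - W‖ * |mu' - mu| := by positivity
      have e4 : 0 ≤ 2 * R * ‖W' - W‖ * ∑ k, |lam' k - lam k| :=
        mul_nonneg (by positivity) (Finset.sum_nonneg fun _ _ => abs_nonneg _)
      have e5 : (C + 2 * R) * ‖W' - W‖ * D =
          C * ‖W' - W‖ * ∑ k, |lam' k - lam k| + C * ‖W' - W‖ * |mu' - mu| +
          2 * R * ‖W' - W‖ * ∑ k, |lam' k - lam k| + 2 * R * ‖W' - W‖ * |mu' - mu| := by
        rw [hD, dev]; ring
      linarith
    have h6 : ∑ k, (d.G k W' - d.G k W) * (lam' k - lam k) =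
        ∑ k, d.G k W' * (lam' k - lam k) - ∑ k, d.G k W * (lam' k - lam k) := by
      rw [← Finset.sum_sub_distrib]
      exact Finset.sum_congr rfl fun k _ => by ring
    have h7 : (mu + mu') * ‖W' - W‖ ^ 2 ≤ (C + 2 * R) * ‖W' - W‖ * D := by
      simp only [val, ← hW, ← hW'] at h1 h2
      rw [h6] at h5
      linarith
    have h8 : 2 * a * ‖W' - W‖ ^ 2 ≤ (C + 2 * R) * ‖W' - W‖ * D := by
      nlinarith [sq_nonneg ‖W' - W‖]
    rw [div_mul_eq_mul_div, le_div_iff₀ (by positivity)]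
    rcases (norm_nonneg (W' - W)).eq_or_lt with h0 | h0
    · rw [← h0, zero_mul]; positivity
    · refine le_of_mul_le_mul_left ?_ h0
      linarith
  have hfin : (C + 2 * R) * ‖W' - W‖ ≤ (C + 2 * R) * ((C + 2 * R) / (2 * a)) * D := by
    rw [mul_assoc]
    exact mul_le_mul_of_nonneg_left hdist (by positivity)
  have hn := norm_nonneg (W' - W)
  refine ⟨fun k => (hG k).trans ?_, hN.trans ?_⟩
  · nlinarith
  · nlinarith

/-- The descent lemma for the dual function. -/
theorem exists_val_le {a : ℝ} (ha : 0 < a) : ∃ Λ, 0 ≤ Λ ∧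
    ∀ lam ∈ d.simplex, ∀ mu, a ≤ mu → ∀ lam' ∈ d.simplex, ∀ mu', a ≤ mu' →
      d.val lam' mu' ≤ d.val lam mu + d.slope lam mu lam' mu' + Λ * dev lam mu lam' mu' ^ 2 := by
  obtain ⟨Λ, hΛ, h⟩ := d.exists_lipschitz ha
  refine ⟨Λ, hΛ, fun lam hl mu hm lam' hl' mu' hm' => ?_⟩
  obtain ⟨hr, hp⟩ := h lam hl mu hm lam' hl' mu' hm'
  -- The supporting function at the new point bounds the new value from above; replacing its slope
  -- by the one at the old point costs the Lipschitz bound times the distance.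
  have h1 := val_add_slope_le (lam := lam') (mu := mu') hl (ha.trans_le hm)
  set D := dev lam mu lam' mu' with hD
  have e1 : ∑ k, (d.rate lam' mu' k - d.rate lam mu k) * (lam' k - lam k) ≤
      Λ * D * ∑ k, |lam' k - lam k| := by
    rw [Finset.mul_sum]
    refine Finset.sum_le_sum fun k _ => (le_abs_self _).trans ?_
    rw [abs_mul]
    exact mul_le_mul_of_nonneg_right (hr k) (abs_nonneg _)
  have e2 : -((d.pw lam' mu' - d.pw lam mu) * (mu' - mu)) ≤ Λ * D * |mu' - mu| := by
    refine (neg_le_abs _).trans ?_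
    rw [abs_mul]
    exact mul_le_mul_of_nonneg_right hp (abs_nonneg _)
  have e3 : Λ * D ^ 2 = Λ * D * ∑ k, |lam' k - lam k| + Λ * D * |mu' - mu| := by
    rw [sq, hD, dev]; ring
  have e4 : ∑ k, (d.rate lam' mu' k - d.rate lam mu k) * (lam' k - lam k) =
      -∑ k, d.rate lam' mu' k * (lam k - lam' k) - ∑ k, d.rate lam mu k * (lam' k - lam k) := by
    rw [← Finset.sum_neg_distrib, ← Finset.sum_sub_distrib]
    exact Finset.sum_congr rfl fun k _ => by ring
  simp only [slope] at *
  linarith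

theorem continuousOn_val {a : ℝ} (ha : 0 < a) :
    ContinuousOn (fun x : (ι → ℝ) × ℝ => d.val x.1 x.2) {x | x.1 ∈ d.simplex ∧ a ≤ x.2} := by
  obtain ⟨Λ, hΛ, h⟩ := d.exists_val_le ha
  rintro ⟨lam, mu⟩ ⟨hl, hm⟩
  have c1 : Continuous fun x : (ι → ℝ) × ℝ => d.val lam mu + d.slope lam mu x.1 x.2 := by
    unfold slope; fun_prop
  have c2 : Continuous fun x : (ι → ℝ) × ℝ =>
      d.val lam mu + d.slope lam mu x.1 x.2 + Λ * dev lam mu x.1 x.2 ^ 2 := by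
    unfold slope dev; fun_prop
  have t1 := (c1.tendsto (lam, mu)).mono_left
    (nhdsWithin_le_nhds (s := {x | x.1 ∈ d.simplex ∧ a ≤ x.2}))
  have t2 := (c2.tendsto (lam, mu)).mono_left
    (nhdsWithin_le_nhds (s := {x | x.1 ∈ d.simplex ∧ a ≤ x.2}))
  refine tendsto_of_tendsto_of_tendsto_of_le_of_le' (g := fun x => d.val lam mu +
    d.slope lam mu x.1 x.2) (h := fun x => d.val lam mu + d.slope lam mu x.1 x.2 +
    Λ * dev lam mu x.1 x.2 ^ 2) ?_ ?_ ?_ ?_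
  · simpa [slope] using t1
  · simpa [slope, dev] using t2
  · filter_upwards [self_mem_nhdsWithin] with x hx
    exact val_add_slope_le hx.1 (ha.trans_le hx.2)
  · filter_upwards [self_mem_nhdsWithin] with x hx
    exact h lam hl mu hm x.1 hx.1 x.2 hx.2

theorem isCompact_simplex : IsCompact d.simplex := by
  refine (isCompact_Icc (a := (0 : ι → ℝ)) (b := fun _ => d.c)).of_isClosed_subset ?_ ?_
  · show IsClosed (Set.Ici (0 : ι → ℝ) ∩ {l | ∑ k, l k = d.c})
    exact isClosed_Ici.inter (isClosed_eq (by fun_prop) continuous_const)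
  · intro l hl
    refine ⟨fun k => hl.1 k, fun k => ?_⟩
    show l k ≤ d.c
    rw [← hl.2]
    exact Finset.single_le_sum (fun i _ => hl.1 i) (Finset.mem_univ k)

end DualModel

/-! ### Saddle points: existence, weak duality and the dual gap. -/

namespace DualModel

variable {ι E : Type*} [Fintype ι] [NormedAddCommGroup E] (d : DualModel ι E)

/-- A primal-dual solution with a positive multiplier `mu` of the power constraint. -/
structure IsSaddle (lam : ι → ℝ) (mu y : ℝ) : Prop where
  mem : lam ∈ d.simplex
  pos : 0 < mu
  pw_eq : d.pw lam mu = d.P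
  le_rate : ∀ k, y ≤ d.rate lam mu k
  eq_rate : ∃ k, y = d.rate lam mu k
  slack : ∀ k, lam k * (y - d.rate lam mu k) = 0

/-- A point with larger objective value (by `κ`) than a given value `v`, when the power constraint
is ignored. -/
def Exceeds (v κ : ℝ) (W : E) (y : ℝ) : Prop :=
  (∀ k, y ≤ d.G k W) ∧ v + κ ≤ d.F W + d.c * y

variable {d} {lam : ι → ℝ} {mu y v κ : ℝ}

theorem mul_le_sum_rate {lam : ι → ℝ} (hl : lam ∈ d.simplex) {r : ι → ℝ} (hr : ∀ k, y ≤ r k) :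
    d.c * y ≤ ∑ k, lam k * r k := by
  rw [← hl.2, Finset.sum_mul]
  exact Finset.sum_le_sum fun k _ => mul_le_mul_of_nonneg_left (hr k) (hl.1 k)

/-- Weak duality at a point that may violate the power budget: its violation is charged only at the
price `mu`, so `val` exceeds `v` markedly for small `mu`. -/
theorem Exceeds.le_val {W : E} (h : d.Exceeds v κ W y) (hl : lam ∈ d.simplex) (hm : 0 < mu) :
    v + κ - mu * ‖W‖ ^ 2 + mu * d.P ≤ d.val lam mu := by
  have h1 := lag_le_val hl hm W
  have h2 := mul_le_sum_rate hl h.1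
  have h3 := h.2
  simp only [lag] at h1
  linarith

/-- Near-optimal dual points have a multiplier `mu` bounded away from zero. -/
theorem Exceeds.le_mu {W : E} (h : d.Exceeds v κ W y) (hl : lam ∈ d.simplex) (hm : 0 < mu)
    (hv : d.val lam mu ≤ v + κ / 2) : κ / 2 / (‖W‖ ^ 2 + 1) ≤ mu := by
  have h1 := h.le_val hl hm
  have h2 := mul_pos hm d.P_pos
  rw [div_le_iff₀ (by positivity)]
  linarith

theorem exists_slope_nonneg [Nonempty ι] {a b : ℝ} (ha : 0 < a) (hab : a ≤ b) :
    ∃ lam ∈ d.simplex, ∃ mu, a ≤ mu ∧ mu ≤ b ∧ ∀ lam' ∈ d.simplex, ∀ mu', a ≤ mu' → mu' ≤ b →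
      0 ≤ d.slope lam mu lam' mu' := by
  classical
  have hne : (d.simplex ×ˢ Set.Icc a b).Nonempty := by
    obtain ⟨k⟩ := ‹Nonempty ι›
    refine ⟨(Pi.single k d.c, a), ⟨fun i => ?_, by simp⟩, le_rfl, hab⟩
    rcases eq_or_ne i k with rfl | h
    · simpa using d.c_nonneg
    · simp [h]
  obtain ⟨⟨lam, mu⟩, ⟨hl, hm1, hm2⟩, hmin⟩ :=
    (d.isCompact_simplex.prod (isCompact_Icc (a := a) (b := b))).exists_isMinOn hne
      ((d.continuousOn_val ha).mono fun x hx => ⟨hx.1, hx.2.1⟩)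
  simp only at hl hm1 hm2
  refine ⟨lam, hl, mu, hm1, hm2, fun lam' hl' mu' h1 h2 => ?_⟩
  obtain ⟨Λ, hΛ, h⟩ := d.exists_val_le ha
  by_contra! hneg
  set A := d.slope lam mu lam' mu' with hA
  set D := dev lam mu lam' mu' with hD
  have key : ∀ s : ℝ, 0 < s → s ≤ 1 → 0 ≤ A + Λ * s * D ^ 2 := by
    intro s hs0 hs1
    have hmem : (fun k => lam k + s * (lam' k - lam k)) ∈ d.simplex := by
      refine ⟨fun k => ?_, ?_⟩
      · have := hl.1 k
        have := hl'.1 k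
        nlinarith
      · rw [Finset.sum_add_distrib, ← Finset.mul_sum, Finset.sum_sub_distrib, hl.2, hl'.2]
        ring
    have hs := h lam hl mu hm1 _ hmem (mu + s * (mu' - mu)) (by nlinarith)
    have hle : d.val lam mu ≤ d.val (fun k => lam k + s * (lam' k - lam k))
        (mu + s * (mu' - mu)) :=
      hmin (a := ((fun k => lam k + s * (lam' k - lam k)), mu + s * (mu' - mu)))
        ⟨hmem, by constructor <;> nlinarith⟩
    have e1 : d.slope lam mu (fun k => lam k + s * (lam' k - lam k)) (mu + s * (mu' - mu)) =
        s * A := by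
      rw [hA, slope, slope, 
        mul_sub s (∑ k, d.rate lam mu k * (lam' k - lam k)), Finset.mul_sum]
      congr 1
      · exact Finset.sum_congr rfl fun k _ => by ring
      · ring
    have e2 : dev lam mu (fun k => lam k + s * (lam' k - lam k)) (mu + s * (mu' - mu)) =
        s * D := by
      rw [hD, dev, dev, mul_add, Finset.mul_sum]
      congr 1
      · refine Finset.sum_congr rfl fun k _ => ?_
        rw [add_sub_cancel_left, abs_mul, abs_of_pos hs0]
      · rw [add_sub_cancel_left, abs_mul, abs_of_pos hs0]
    rw [e1, e2] at hs
    have : 0 ≤ s * (A + Λ * s * D ^ 2) := by nlinarith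
    exact nonneg_of_mul_nonneg_right this hs0
  have hpos : 0 < Λ * D ^ 2 + 1 := by positivity
  -- A step so short that the quadratic error `Λ * s * D ^ 2` cannot compensate the negative slope
  -- `A`.
  have hs := key (min 1 (-A / (Λ * D ^ 2 + 1))) (lt_min one_pos (div_pos (by linarith) hpos))
    (min_le_left _ _)
  have h3 : min 1 (-A / (Λ * D ^ 2 + 1)) * (Λ * D ^ 2 + 1) ≤ -A := by
    rw [← le_div_iff₀ hpos]
    exact min_le_right _ _
  have h4 : 0 < min 1 (-A / (Λ * D ^ 2 + 1)) := lt_min one_pos (div_pos (by linarith) hpos)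
  nlinarith

/-- Minimise `val` over a box for `mu` whose ends do not obstruct optimality. Moving `mu` both ways
gives equality in the power constraint; moving all weight to a worst user gives complementary
slackness. -/
theorem exists_isSaddle [Nonempty ι] {W : E} (hκ : 0 < κ) (hW : d.Exceeds v κ W y)
    (hv : ∀ W' y', (∀ k, y' ≤ d.G k W') → ‖W'‖ ^ 2 ≤ d.P → d.F W' + d.c * y' ≤ v) :
    ∃ lam mu y, d.IsSaddle lam mu y := by
  classical
  obtain ⟨C, hC, hsq⟩ := d.exists_mul_sq_le
  have hP := d.P_pos
  set a := κ / 2 / (‖W‖ ^ 2 + 1) with ha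
  have ha0 : 0 < a := by positivity
  have haW : a * (‖W‖ ^ 2 + 1) = κ / 2 := div_mul_cancel₀ _ (by positivity)
  -- The right end lies beyond `C / P`: excess power would force `mu < C / P`, leaving room to
  -- increase `mu` and lower `val`.
  obtain ⟨lam, hl, mu, h1, h2, hs⟩ := exists_slope_nonneg (d := d) (a := a)
    (b := a + C / d.P + 1) ha0 (by have : 0 ≤ C / d.P := by positivity
                                   linarith)
  have hmu : 0 < mu := ha0.trans_le h1
  have hdir : ∀ mu', a ≤ mu' → mu' ≤ a + C / d.P + 1 →
      (d.pw lam mu - d.P) * (mu' - mu) ≤ 0 := by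
    intro mu' h3 h4
    have := hs lam hl mu' h3 h4
    simp only [slope, sub_self, mul_zero, Finset.sum_const_zero, zero_sub] at this
    linarith
  have hb : d.pw lam mu ≤ d.P := by
    by_contra! hlt
    have h3 := hsq lam hl mu hmu
    have h4 : mu * d.P < C := lt_of_lt_of_le (mul_lt_mul_of_pos_left hlt hmu) h3
    have h5 : mu < C / d.P := by rwa [lt_div_iff₀ hP]
    have h6 := hdir (a + C / d.P + 1) (by have : 0 ≤ C / d.P := by positivity
                                          linarith) le_rfl
    nlinarith
  obtain ⟨m, hm⟩ := Finite.exists_min (d.rate lam mu)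
  have hopt : ∑ k, lam k * d.rate lam mu k = d.c * d.rate lam mu m := by
    refine le_antisymm ?_ (mul_le_sum_rate hl hm)
    have h3 := hs (Pi.single m d.c) ⟨fun i => ?_, by simp⟩ mu h1 h2
    · simp only [slope, sub_self, mul_zero, sub_zero, mul_sub, Finset.sum_sub_distrib] at h3
      rw [Finset.sum_eq_single m (by intro b _ hb; simp [hb]) (by simp)] at h3
      simp only [Pi.single_eq_same] at h3
      have : ∑ k, lam k * d.rate lam mu k = ∑ k, d.rate lam mu k * lam k :=
        Finset.sum_congr rfl fun k _ => mul_comm _ _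
      linarith
    · rcases eq_or_ne i m with rfl | h
      · simpa using d.c_nonneg
      · simp [h]
  have hpw : d.pw lam mu = d.P := by
    rcases h1.eq_or_lt with h3 | h3
    -- At the left end the maximiser is feasible, so its objective is at most `v`; but `a` is so
    -- small that the power-violating point still gains `κ / 2`.
    · exfalso
      have h4 := hv (d.sol lam mu) (d.rate lam mu m) hm hb
      have h5 := hW.le_val hl hmu
      have h6 : d.val lam mu = d.F (d.sol lam mu) + ∑ k, lam k * d.rate lam mu k -
        mu * (d.pw lam mu - d.P) := rfl
      have h7 : 0 ≤ mu * d.pw lam mu := mul_nonneg hmu.le (sq_nonneg _)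
      rw [← h3] at h5 h6 h7 hopt h4
      nlinarith
    · have := hdir a le_rfl (by have : 0 ≤ C / d.P := by positivity
                                linarith)
      refine le_antisymm hb ?_
      by_contra! hlt
      nlinarith
  refine ⟨lam, mu, d.rate lam mu m, hl, hmu, hpw, hm, ⟨m, rfl⟩, fun k => ?_⟩
  have h3 : ∑ k, lam k * (d.rate lam mu k - d.rate lam mu m) = 0 := by
    simp only [mul_sub, Finset.sum_sub_distrib]
    rw [← Finset.sum_mul, hl.2, hopt, sub_self]
  rw [Finset.sum_eq_zero_iff_of_nonneg
    fun k _ => mul_nonneg (hl.1 k) (sub_nonneg.2 (hm k))] at h3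
  have := h3 k (Finset.mem_univ k)
  linarith

variable {ls : ι → ℝ} {ms ys : ℝ}

theorem IsSaddle.val_eq (h : d.IsSaddle ls ms ys) :
    d.val ls ms = d.F (d.sol ls ms) + d.c * ys := by
  have h1 : ∑ k, ls k * (ys - d.rate ls ms k) = 0 := Finset.sum_eq_zero fun k _ => h.slack k
  simp only [mul_sub, Finset.sum_sub_distrib, ← Finset.sum_mul, h.mem.2] at h1
  have h2 : ms * (d.pw ls ms - d.P) = 0 := by rw [h.pw_eq, sub_self, mul_zero]
  simp only [rate, pw] at h1 h2
  simp only [val, lag]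
  linarith

/-- The primal solution is tested in the Lagrangian of an arbitrary dual point. The growth term
makes the dual gap control the distance of the maximisers. -/
theorem IsSaddle.add_growth_le (h : d.IsSaddle ls ms ys) (hl : lam ∈ d.simplex) (hm : 0 < mu) :
    d.val ls ms + mu * ‖d.sol ls ms - d.sol lam mu‖ ^ 2 ≤ d.val lam mu := by
  have h1 := lag_add_le_val hl hm (d.sol ls ms)
  have h2 := mul_le_sum_rate hl h.le_rate
  have h3 : mu * (d.pw ls ms - d.P) = 0 := by rw [h.pw_eq, sub_self, mul_zero]
  have h4 := h.val_eq
  simp only [rate, pw] at h2 h3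
  simp only [lag] at h1
  linarith

theorem IsSaddle.val_le (h : d.IsSaddle ls ms ys) (hl : lam ∈ d.simplex) (hm : 0 < mu) :
    d.val ls ms ≤ d.val lam mu := by
  have h1 := h.add_growth_le hl hm
  have : 0 ≤ mu * ‖d.sol ls ms - d.sol lam mu‖ ^ 2 := by positivity
  linarith

theorem IsSaddle.primal_le (h : d.IsSaddle ls ms ys) {W : E} (hy : ∀ k, y ≤ d.G k W)
    (hp : ‖W‖ ^ 2 ≤ d.P) :
    d.F W + d.c * y + ms * ‖W - d.sol ls ms‖ ^ 2 ≤ d.F (d.sol ls ms) + d.c * ys := by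
  have h1 := lag_add_le_val h.mem h.pos W
  have h2 := mul_le_sum_rate h.mem hy
  have h3 := h.val_eq
  have h4 := h.pos
  simp only [lag] at h1
  nlinarith

/-- Dual points with optimal value are multipliers of the same primal solution. -/
theorem IsSaddle.of_val_eq (h : d.IsSaddle ls ms ys) (hl : lam ∈ d.simplex) (hm : 0 < mu)
    (hv : d.val lam mu = d.val ls ms) : d.sol lam mu = d.sol ls ms ∧ d.IsSaddle lam mu ys := by
  have h1 := h.add_growth_le hl hm
  have h2 : ‖d.sol ls ms - d.sol lam mu‖ ^ 2 ≤ 0 := by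
    by_contra! h3
    nlinarith [mul_pos hm h3]
  have h3 : d.sol lam mu = d.sol ls ms := by
    have h4 : ‖d.sol ls ms - d.sol lam mu‖ = 0 := by
      rw [← sq_eq_zero_iff]
      exact le_antisymm h2 (sq_nonneg _)
    exact (sub_eq_zero.1 (norm_eq_zero.1 h4)).symm
  have hr : d.rate lam mu = d.rate ls ms := by
    funext k; rw [rate, rate, h3]
  have hp : d.pw lam mu = d.P := by rw [pw, h3]; exact h.pw_eq
  refine ⟨h3, hl, hm, hp, by rw [hr]; exact h.le_rate, by rw [hr]; exact h.eq_rate, ?_⟩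
  have h4 : d.val lam mu = d.F (d.sol ls ms) + ∑ k, lam k * d.rate ls ms k := by
    rw [← hr, ← h3]
    simp only [val, lag, pw, rate] at hp ⊢
    rw [hp]; ring
  have h5 : ∑ k, lam k * (d.rate ls ms k - ys) = 0 := by
    simp only [mul_sub, Finset.sum_sub_distrib]
    rw [← Finset.sum_mul, hl.2]
    have := h.val_eq
    linarith
  rw [Finset.sum_eq_zero_iff_of_nonneg
    fun k _ => mul_nonneg (hl.1 k) (sub_nonneg.2 (h.le_rate k))] at h5
  intro k
  have := h5 k (Finset.mem_univ k)
  rw [hr]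
  linarith

/-- The gap of the dual function is controlled by the slack terms of the iteration. -/
theorem IsSaddle.gap_le (h : d.IsSaddle ls ms ys) (hl : lam ∈ d.simplex) {m : ι}
    (hm : ∀ k, d.rate lam mu m ≤ d.rate lam mu k) :
    d.val lam mu - d.val ls ms ≤
      ∑ k, (d.rate lam mu k - d.rate lam mu m) * lam k + (d.P - d.pw lam mu) * (mu - ms) := by
  -- Convexity, with the supporting function at the current point evaluated at the saddle point.
  have h1 := val_add_slope_le (lam := lam) (mu := mu) h.mem h.pos
  have h2 := mul_le_sum_rate h.mem hm
  have h3 : ∑ k, (d.rate lam mu k - d.rate lam mu m) * lam k =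
      ∑ k, d.rate lam mu k * lam k - d.c * d.rate lam mu m := by
    simp only [sub_mul, Finset.sum_sub_distrib]
    rw [← Finset.mul_sum, hl.2, mul_comm]
  have h4 : ∑ k, ls k * d.rate lam mu k = ∑ k, d.rate lam mu k * ls k :=
    Finset.sum_congr rfl fun k _ => mul_comm _ _
  simp only [slope, mul_sub, Finset.sum_sub_distrib] at h1
  linarith

end DualModel

/-! ### One step of the iteration: decrease of `val` and growth of the barrier. -/

namespace DualModel

variable {ι E : Type*} [Fintype ι] [NormedAddCommGroup E] (d : DualModel ι E)

/-- One step of the hyperplane fixed-point iteration for `lam`. -/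
noncomputable def stepLam [DecidableEq ι] (ρ : ℝ) (m : ι) (lam : ι → ℝ) (mu : ℝ) : ι → ℝ := fun k =>
  if k = m then
    lam m + ∑ i, (1 - (d.rate lam mu m + ρ) / (d.rate lam mu i + ρ)) * lam i
  else (d.rate lam mu m + ρ) / (d.rate lam mu k + ρ) * lam k

/-- One step of the fixed-point iteration for `mu`. -/
noncomputable def stepMu (ρ : ℝ) (lam : ι → ℝ) (mu : ℝ) : ℝ :=
  (d.pw lam mu + ρ) / (d.P + ρ) * mu

/-- The first-order decrease of the dual function in one step. -/
noncomputable def decr (ρ : ℝ) (m : ι) (lam : ι → ℝ) (mu : ℝ) : ℝ :=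
  ∑ k, (d.rate lam mu k - d.rate lam mu m) ^ 2 * lam k / (d.rate lam mu k + ρ) +
    (d.pw lam mu - d.P) ^ 2 * mu / (d.P + ρ)

variable {d} {lam : ι → ℝ} {mu ρ : ℝ} {m : ι}

/-- Mass transport: every user gives up a fraction of its weight, and the worst user `m` collects
the total. -/
theorem stepLam_eq [DecidableEq ι] (hρ : ∀ k, 0 < d.rate lam mu k + ρ) (k : ι) :
    d.stepLam ρ m lam mu k =
      lam k - (d.rate lam mu k - d.rate lam mu m) * lam k / (d.rate lam mu k + ρ) +
        if k = m then
          ∑ i, (d.rate lam mu i - d.rate lam mu m) * lam i / (d.rate lam mu i + ρ)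
        else 0 := by
  have h : ∀ i, (1 - (d.rate lam mu m + ρ) / (d.rate lam mu i + ρ)) * lam i =
      (d.rate lam mu i - d.rate lam mu m) * lam i / (d.rate lam mu i + ρ) := by
    intro i
    have := (hρ i).ne'
    field_simp
    ring
  rw [stepLam]
  split_ifs with hk
  · subst hk
    simp only [h, sub_self, zero_mul, zero_div, sub_zero]
  · rw [← h]; ring

/-- The fraction given up is at least zero because `m` is worst, and less than one because `rate m +
ρ` is positive. -/
theorem stepLam_mem [DecidableEq ι] (hl : lam ∈ d.simplex) (hm : ∀ k, d.rate lam mu m ≤ d.rate lam mu k)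
    (hρ : ∀ k, 0 < d.rate lam mu k + ρ) : d.stepLam ρ m lam mu ∈ d.simplex := by
  refine ⟨fun k => ?_, ?_⟩
  · rw [stepLam_eq hρ]
    have h1 : (d.rate lam mu k - d.rate lam mu m) * lam k / (d.rate lam mu k + ρ) ≤ lam k := by
      rw [div_le_iff₀ (hρ k)]
      have := hρ m
      nlinarith [hl.1 k]
    have h2 : 0 ≤ ∑ i, (d.rate lam mu i - d.rate lam mu m) * lam i / (d.rate lam mu i + ρ) :=
      Finset.sum_nonneg fun i _ =>
        div_nonneg (mul_nonneg (sub_nonneg.2 (hm i)) (hl.1 i)) (hρ i).le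
    split_ifs <;> linarith
  · simp only [stepLam_eq hρ, Finset.sum_add_distrib, Finset.sum_sub_distrib, hl.2,
      Finset.sum_ite_eq', Finset.mem_univ, if_true]
    ring

/-- Mass moved from `k` to `m` changes `val` to first order at the rate `rate m - rate k`, and the
amount moved carries the factor `rate k - rate m`; hence the squares. -/
theorem slope_step [DecidableEq ι] (hρ : ∀ k, 0 < d.rate lam mu k + ρ) (hP : 0 < d.P + ρ) :
    d.slope lam mu (d.stepLam ρ m lam mu) (d.stepMu ρ lam mu) = -d.decr ρ m lam mu := by
  have h1 : d.stepMu ρ lam mu - mu = (d.pw lam mu - d.P) * mu / (d.P + ρ) := by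
    rw [stepMu]; field_simp; ring
  have h2 : ∑ k, d.rate lam mu k * (d.stepLam ρ m lam mu k - lam k) =
      -∑ k, (d.rate lam mu k - d.rate lam mu m) ^ 2 * lam k / (d.rate lam mu k + ρ) := by
    have h3 : ∀ k, d.rate lam mu k * (d.stepLam ρ m lam mu k - lam k) =
        -(d.rate lam mu k * ((d.rate lam mu k - d.rate lam mu m) * lam k /
          (d.rate lam mu k + ρ))) + if k = m then d.rate lam mu m *
          ∑ i, (d.rate lam mu i - d.rate lam mu m) * lam i / (d.rate lam mu i + ρ) else 0 := by
      intro k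
      rw [stepLam_eq hρ]
      split_ifs with hk
      · rw [hk]; ring
      · ring
    simp only [h3, Finset.sum_add_distrib, Finset.sum_ite_eq', Finset.mem_univ, if_true,
      Finset.mul_sum, ← Finset.sum_neg_distrib]
    rw [← Finset.sum_add_distrib]
    exact Finset.sum_congr rfl fun k _ => by ring
  rw [slope, h1, h2, decr]
  ring

theorem decr_nonneg (hl : lam ∈ d.simplex) (hmu : 0 < mu)
    (hρ : ∀ k, 0 < d.rate lam mu k + ρ) (hP : 0 < d.P + ρ) : 0 ≤ d.decr ρ m lam mu :=
  add_nonneg (Finset.sum_nonneg fun k _ =>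
    div_nonneg (mul_nonneg (sq_nonneg _) (hl.1 k)) (hρ k).le) (by positivity)

/-- Cauchy-Schwarz with weights `lam`, whose sum is `c`; the denominators in `decr` are at most `2 *
ρ`. -/
theorem sq_sum_le_decr (hl : lam ∈ d.simplex) (hmu : 0 < mu) (hρ0 : 0 < ρ)
    (hρ : ∀ k, 0 < d.rate lam mu k + ρ ∧ d.rate lam mu k ≤ ρ) :
    (∑ k, (d.rate lam mu k - d.rate lam mu m) * lam k) ^ 2 ≤
      2 * ρ * d.c * d.decr ρ m lam mu := by
  have h1 := Finset.sum_sq_le_sum_mul_sum_of_sq_le_mul Finset.univ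
    (r := fun k => (d.rate lam mu k - d.rate lam mu m) * lam k) (f := lam)
    (g := fun k => (d.rate lam mu k - d.rate lam mu m) ^ 2 * lam k) (fun k _ => hl.1 k)
    (fun k _ => mul_nonneg (sq_nonneg _) (hl.1 k)) (fun k _ => le_of_eq (by ring))
  rw [hl.2] at h1
  have h2 : ∑ k, (d.rate lam mu k - d.rate lam mu m) ^ 2 * lam k ≤ 2 * ρ *
      ∑ k, (d.rate lam mu k - d.rate lam mu m) ^ 2 * lam k / (d.rate lam mu k + ρ) := by
    rw [Finset.mul_sum]
    refine Finset.sum_le_sum fun k _ => ?_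
    rw [← mul_div_assoc, le_div_iff₀ (hρ k).1, mul_comm]
    exact mul_le_mul_of_nonneg_right (by linarith [(hρ k).2])
      (mul_nonneg (sq_nonneg _) (hl.1 k))
  have h3 : 0 ≤ (d.pw lam mu - d.P) ^ 2 * mu / (d.P + ρ) := by
    have := d.P_pos
    positivity
  have h4 : 2 * ρ * ∑ k, (d.rate lam mu k - d.rate lam mu m) ^ 2 * lam k /
      (d.rate lam mu k + ρ) ≤ 2 * ρ * d.decr ρ m lam mu :=
    mul_le_mul_of_nonneg_left (by rw [decr]; linarith) (by positivity)
  calc _ ≤ _ := h1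
    _ ≤ d.c * (2 * ρ * d.decr ρ m lam mu) :=
      mul_le_mul_of_nonneg_left (h2.trans h4) d.c_nonneg
    _ = _ := by ring

/-- Cauchy-Schwarz again, now with weights `lam k / (rate k + ρ)`, whose sum is at most `2 * c / ρ`.
This is the source of the factor `1 / ρ`. -/
theorem dev_sq_le_decr [DecidableEq ι] (hl : lam ∈ d.simplex) (hmu : 0 < mu) {b : ℝ} (hb : mu ≤ b) (hρ0 : 0 < ρ)
    (hm : ∀ k, d.rate lam mu m ≤ d.rate lam mu k)
    (hρ : ∀ k, ρ / 2 ≤ d.rate lam mu k + ρ) :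
    dev lam mu (d.stepLam ρ m lam mu) (d.stepMu ρ lam mu) ^ 2 ≤
      (16 * d.c + 2 * b) / ρ * d.decr ρ m lam mu := by
  have hP := d.P_pos
  have hρ' : ∀ k, 0 < d.rate lam mu k + ρ := fun k => by linarith [hρ k]
  set u : ι → ℝ := fun k => (d.rate lam mu k - d.rate lam mu m) * lam k / (d.rate lam mu k + ρ)
    with hu
  have hu0 : ∀ k, 0 ≤ u k := fun k =>
    div_nonneg (mul_nonneg (sub_nonneg.2 (hm k)) (hl.1 k)) (hρ' k).le
  set S := ∑ k, u k with hS
  have hS0 : 0 ≤ S := Finset.sum_nonneg fun k _ => hu0 k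
  set X := ∑ k, (d.rate lam mu k - d.rate lam mu m) ^ 2 * lam k / (d.rate lam mu k + ρ) with hX
  set Y := (d.pw lam mu - d.P) ^ 2 * mu / (d.P + ρ) with hY
  have hX0 : 0 ≤ X := Finset.sum_nonneg fun k _ =>
    div_nonneg (mul_nonneg (sq_nonneg _) (hl.1 k)) (hρ' k).le
  have hY0 : 0 ≤ Y := by positivity
  have h1 : ∑ k, |d.stepLam ρ m lam mu k - lam k| ≤ 2 * S := by
    calc _ ≤ ∑ k, (u k + if k = m then S else 0) := by
          refine Finset.sum_le_sum fun k _ => ?_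
          rw [stepLam_eq hρ', abs_le]
          have := hu0 k
          simp only [hu] at this
          split_ifs <;> constructor <;> simp only [hu, hS] at * <;> linarith
      _ = 2 * S := by
          rw [Finset.sum_add_distrib, Finset.sum_ite_eq', if_pos (Finset.mem_univ m)]
          ring
  have h2 : S ^ 2 ≤ 2 * d.c / ρ * X := by
    have h3 := Finset.sum_sq_le_sum_mul_sum_of_sq_le_mul Finset.univ (r := u)
      (f := fun k => lam k / (d.rate lam mu k + ρ))
      (g := fun k => (d.rate lam mu k - d.rate lam mu m) ^ 2 * lam k / (d.rate lam mu k + ρ))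
      (fun k _ => div_nonneg (hl.1 k) (hρ' k).le)
      (fun k _ => div_nonneg (mul_nonneg (sq_nonneg _) (hl.1 k)) (hρ' k).le)
      (fun k _ => le_of_eq (by simp only [hu]; ring))
    refine h3.trans (mul_le_mul_of_nonneg_right ?_ hX0)
    rw [← hl.2, Finset.mul_sum, Finset.sum_div]
    refine Finset.sum_le_sum fun k _ => ?_
    rw [div_le_div_iff₀ (hρ' k) hρ0]
    nlinarith [hl.1 k, hρ k]
  have h4 : |d.stepMu ρ lam mu - mu| ^ 2 ≤ b / ρ * Y := by
    have h5 : d.stepMu ρ lam mu - mu = (d.pw lam mu - d.P) * mu / (d.P + ρ) := by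
      rw [stepMu]; field_simp; ring
    have h6 : |d.stepMu ρ lam mu - mu| ^ 2 = mu / (d.P + ρ) * Y := by
      rw [sq_abs, h5, hY]; field_simp
    rw [h6]
    refine mul_le_mul_of_nonneg_right ?_ hY0
    exact div_le_div₀ (hmu.le.trans hb) hb hρ0 (by linarith)
  have h7 : dev lam mu (d.stepLam ρ m lam mu) (d.stepMu ρ lam mu) ^ 2 ≤
      (2 * S + |d.stepMu ρ lam mu - mu|) ^ 2 :=
    pow_le_pow_left₀ (dev_nonneg _ _ _ _) (by rw [dev]; linarith) 2
  have h8 : (16 * d.c + 2 * b) / ρ * d.decr ρ m lam mu =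
      8 * (2 * d.c / ρ * X) + 2 * (b / ρ * Y) + (16 * (d.c / ρ * Y) + 2 * (b / ρ * X)) := by
    rw [decr]; ring
  have h9 : 0 ≤ d.c / ρ * Y := by have := d.c_nonneg; positivity
  have h10 : 0 ≤ b / ρ * X := mul_nonneg (div_nonneg (hmu.le.trans hb) hρ0.le) hX0
  -- With `t` the change of `mu`, `(2 * S + t) ^ 2 ≤ 8 * S ^ 2 + 2 * t ^ 2` produces `16 * c` and `2
  -- * b`; the mixed terms are nonnegative surplus.
  nlinarith [sq_nonneg (2 * S - |d.stepMu ρ lam mu - mu|)]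

theorem half_le_stepMu (hmu : 0 < mu) (hρ : d.P ≤ ρ) : mu / 2 ≤ d.stepMu ρ lam mu := by
  have hP := d.P_pos
  have h : 0 ≤ d.pw lam mu := sq_nonneg _
  rw [stepMu, div_mul_eq_mul_div, le_div_iff₀ (by linarith)]
  nlinarith

/-- Sufficient decrease of the dual function in one step. -/
theorem val_step_le [DecidableEq ι] {a b Λ : ℝ} (ha : 0 < a) (hΛ : 0 ≤ Λ)
    (hval : ∀ lam ∈ d.simplex, ∀ mu, a / 2 ≤ mu → ∀ lam' ∈ d.simplex, ∀ mu', a / 2 ≤ mu' →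
      d.val lam' mu' ≤ d.val lam mu + d.slope lam mu lam' mu' + Λ * dev lam mu lam' mu' ^ 2)
    (hl : lam ∈ d.simplex) (hmu : a ≤ mu) (hb : mu ≤ b) (hPρ : d.P ≤ ρ)
    (hΛρ : 2 * Λ * (16 * d.c + 2 * b) ≤ ρ) (hm : ∀ k, d.rate lam mu m ≤ d.rate lam mu k)
    (hρ : ∀ k, ρ / 2 ≤ d.rate lam mu k + ρ) :
    d.val (d.stepLam ρ m lam mu) (d.stepMu ρ lam mu) ≤ d.val lam mu - d.decr ρ m lam mu / 2 := by
  have hP := d.P_pos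
  have hρ0 : 0 < ρ := hP.trans_le hPρ
  have hmu0 := ha.trans_le hmu
  have hρ' : ∀ k, 0 < d.rate lam mu k + ρ := fun k => by linarith [hρ k]
  -- A priori the new `mu` is only known to be at least half the old one, hence the smoothness
  -- constant at level `a / 2`.
  have h1 := hval lam hl mu (by linarith) _ (stepLam_mem hl hm hρ') _
    (le_trans (by linarith) (half_le_stepMu (lam := lam) hmu0 hPρ))
  rw [slope_step hρ' (by linarith)] at h1
  have h2 := dev_sq_le_decr hl hmu0 hb hρ0 hm hρ
  have h3 := decr_nonneg (m := m) hl hmu0 hρ' (by linarith : 0 < d.P + ρ)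
  have h4 : Λ * ((16 * d.c + 2 * b) / ρ * d.decr ρ m lam mu) ≤ d.decr ρ m lam mu / 2 := by
    have h5 : Λ * ((16 * d.c + 2 * b) / ρ) ≤ 1 / 2 := by
      rw [← mul_div_assoc, div_le_iff₀ hρ0]; linarith
    have := mul_le_mul_of_nonneg_right h5 h3
    linarith
  have h5 := mul_le_mul_of_nonneg_left h2 hΛ
  linarith

/-- The barrier `mu - ms * log mu` grows at most as fast as the dual function decreases, as long
as the dual gap is at least `ε`. -/
theorem IsSaddle.barrier_step_le {ls : ι → ℝ} {ms ys a ε : ℝ} (h : d.IsSaddle ls ms ys)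
    (ha : 0 < a) (hε : 0 < ε) (hl : lam ∈ d.simplex) (hmu : a ≤ mu) (hPρ : d.P ≤ ρ)
    (hms : 2 * ms ≤ a * ρ) (hm : ∀ k, d.rate lam mu m ≤ d.rate lam mu k)
    (hρ : ∀ k, 0 < d.rate lam mu k + ρ ∧ d.rate lam mu k ≤ ρ)
    (hgap : ε ≤ d.val lam mu - d.val ls ms) :
    d.stepMu ρ lam mu - ms * Real.log (d.stepMu ρ lam mu) ≤
      mu - ms * Real.log mu + (1 + d.c / (2 * ε)) * d.decr ρ m lam mu := by
  have hP := d.P_pos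
  have hρ0 : 0 < ρ := hP.trans_le hPρ
  have hmu0 := ha.trans_le hmu
  have hc := d.c_nonneg
  have hms0 := h.pos
  have hPρ0 : 0 < d.P + ρ := by linarith
  set r := (d.pw lam mu - d.P) / (d.P + ρ) with hr
  have hq : 0 ≤ d.pw lam mu := sq_nonneg _
  -- The relative change `r` of `mu` is at least `-1/2` by `P ≤ ρ`, which is exactly the range where
  -- the bound `hlog` follows from `1 - 1 / (1 + r)`.
  have hr2 : -(1 / 2) ≤ r := by
    rw [hr, le_div_iff₀ hPρ0]; linarith
  have hrP : r * (d.P + ρ) = d.pw lam mu - d.P := div_mul_cancel₀ _ hPρ0.ne'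
  have hstep : d.stepMu ρ lam mu = (1 + r) * mu := by
    rw [stepMu, hr]; field_simp; ring
  have hlog : r - 2 * r ^ 2 ≤ Real.log (1 + r) := by
    refine le_trans ?_ (Real.one_sub_inv_le_log_of_pos (by linarith : 0 < 1 + r))
    have : 1 - (1 + r)⁻¹ = r / (1 + r) := by
      have : 1 + r ≠ 0 := by linarith
      field_simp; ring
    rw [this, le_div_iff₀ (by linarith)]
    nlinarith [sq_nonneg r]
  rw [hstep, Real.log_mul (by linarith) hmu0.ne']
  set S := ∑ k, (d.rate lam mu k - d.rate lam mu m) * lam k with hS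
  have hS2 := sq_sum_le_decr (m := m) hl hmu0 hρ0 hρ
  have hdec := decr_nonneg (m := m) hl hmu0 (fun k => (hρ k).1) hPρ0
  have hg := h.gap_le hl hm
  rw [← hS] at hS2 hg
  -- The gap is at least `ε`, and `S - ε ≤ S ^ 2 / (4 * ε)`.
  have h1 : S - (d.val lam mu - d.val ls ms) ≤ 2 * ρ * d.c * d.decr ρ m lam mu / (4 * ε) := by
    rw [le_div_iff₀ (by positivity)]
    nlinarith [sq_nonneg (S - 2 * ε)]
  -- The factor `ρ` in the previous bound is absorbed by the denominator `P + ρ` of `r`, so the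
  -- constant does not depend on `ρ`.
  have h2 : (mu - ms) * r ≤ d.c / (2 * ε) * d.decr ρ m lam mu := by
    have h3 : (mu - ms) * r * (d.P + ρ) ≤ S - (d.val lam mu - d.val ls ms) := by
      rw [mul_assoc, hrP]; linarith
    have h4 : 2 * ρ * d.c * d.decr ρ m lam mu / (4 * ε) =
        d.c / (2 * ε) * d.decr ρ m lam mu * ρ := by
      field_simp; ring
    have h5 : 0 ≤ d.c / (2 * ε) * d.decr ρ m lam mu := by positivity
    refine le_of_mul_le_mul_right ?_ hPρ0
    nlinarith
  -- The power term of `decr` equals `r ^ 2 * mu * (P + ρ)`, which dominates the quadratic loss in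
  -- the logarithm once `a * ρ ≥ 2 * ms`.
  have h3 : 2 * ms * r ^ 2 ≤ d.decr ρ m lam mu := by
    have h4 : (d.pw lam mu - d.P) ^ 2 * mu / (d.P + ρ) = r ^ 2 * (mu * (d.P + ρ)) := by
      rw [← hrP]; field_simp
    have h5 : 0 ≤ ∑ k, (d.rate lam mu k - d.rate lam mu m) ^ 2 * lam k / (d.rate lam mu k + ρ) :=
      Finset.sum_nonneg fun k _ =>
        div_nonneg (mul_nonneg (sq_nonneg _) (hl.1 k)) (hρ k).1.le
    have h6 : 2 * ms ≤ mu * (d.P + ρ) := by nlinarith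
    rw [decr, h4]
    nlinarith [mul_le_mul_of_nonneg_right h6 (sq_nonneg r)]
  have h7 := mul_le_mul_of_nonneg_left hlog hms0.le
  linarith

end DualModel

/-! ### Runs of the iteration: uniform bounds and convergence. -/

namespace DualModel

variable {ι E : Type*} [Fintype ι] [NormedAddCommGroup E] (d : DualModel ι E)

/-- A run of the hyperplane fixed-point iteration. -/
structure IsRun [DecidableEq ι] (ρ : ℝ) (lam : ℕ → ι → ℝ) (mu : ℕ → ℝ) (m : ℕ → ι) : Prop where
  worst : ∀ t k, d.rate (lam t) (mu t) (m t) ≤ d.rate (lam t) (mu t) k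
  lam_succ : ∀ t, lam (t + 1) = d.stepLam ρ (m t) (lam t) (mu t)
  mu_succ : ∀ t, mu (t + 1) = d.stepMu ρ (lam t) (mu t)

theorem exists_abs_rate_le {a : ℝ} (ha : 0 < a) : ∃ B, 0 ≤ B ∧ ∀ lam ∈ d.simplex, ∀ mu, a ≤ mu →
    ∀ k, |d.rate lam mu k| ≤ B := by
  obtain ⟨R, hR, hsol⟩ := d.exists_norm_sol_le ha
  obtain ⟨C, hC, hlip⟩ := d.lip R
  refine ⟨∑ k, |d.G k 0| + C * R, add_nonneg (Finset.sum_nonneg fun _ _ => abs_nonneg _)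
    (by positivity), fun lam hl mu hm k => ?_⟩
  have h1 := hlip k 0 (d.sol lam mu) (by simpa using hR) (hsol lam hl mu hm)
  have h2 : C * ‖d.sol lam mu - 0‖ ≤ C * R := by
    rw [sub_zero]
    exact mul_le_mul_of_nonneg_left (hsol lam hl mu hm) hC
  have h3 := Finset.single_le_sum (f := fun k => |d.G k 0|) (fun i _ => abs_nonneg _)
    (Finset.mem_univ k)
  have h4 := abs_sub_abs_le_abs_sub (d.G k (d.sol lam mu)) (d.G k 0)
  simp only [rate]
  linarith

variable {d} {ls : ι → ℝ} {ms ys : ℝ}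

/-- Along a run with large `ρ` the multiplier `mu` stays in a compact subset of `(0, ∞)`, and the
dual function decreases. -/
theorem IsSaddle.exists_run_bounds [DecidableEq ι] (h : d.IsSaddle ls ms ys) {κ y : ℝ} {W : E}
    (hκ : 0 < κ) (hW : d.Exceeds (d.val ls ms) κ W y) {lam₀ : ι → ℝ} {mu₀ : ℝ}
    (hl₀ : lam₀ ∈ d.simplex) (hmu₀ : 0 < mu₀) :
    ∃ a b ρ₀ : ℝ, 0 < a ∧ 0 < ρ₀ ∧ ∀ ρ, ρ₀ ≤ ρ → ∀ lam mu m, lam 0 = lam₀ → mu 0 = mu₀ →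
      d.IsRun ρ lam mu m → ∀ t, lam t ∈ d.simplex ∧ a ≤ mu t ∧ mu t ≤ b ∧
        (∀ k, 0 < d.rate (lam t) (mu t) k + ρ ∧ d.rate (lam t) (mu t) k ≤ ρ) ∧
        d.val (lam (t + 1)) (mu (t + 1)) ≤
          d.val (lam t) (mu t) - d.decr ρ (m t) (lam t) (mu t) / 2 := by
  have hP := d.P_pos
  have hc := d.c_nonneg
  have hms := h.pos
  obtain ⟨A, hA⟩ := d.exists_lag_zero_ge
  set D₀ := d.val lam₀ mu₀ with hD₀
  set Ds := d.val ls ms with hDs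
  set ε := κ / 2 with hε
  have hε0 : 0 < ε := by positivity
  -- Twice the constant of `barrier_step_le`, since `val` is only guaranteed to drop by `decr / 2`.
  -- With this weight `V + C * val` does not increase while the gap is at least `ε`.
  set C := 2 * (1 + d.c / (2 * ε)) with hC
  have hC0 : 0 ≤ C := by positivity
  set V : ℝ → ℝ := fun x => x - ms * Real.log x with hV
  set B := V mu₀ + C * (D₀ - Ds) with hB
  -- The first bound serves dual gaps up to `ε`; the second is what `V mu ≤ B` gives, as `-ms * log
  -- mu ≤ V mu`. Neither involves `ρ`.
  set a := min (ε / (‖W‖ ^ 2 + 1)) (Real.exp (-B / ms)) with ha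
  have ha0 : 0 < a := lt_min (by positivity) (Real.exp_pos _)
  set b := (D₀ - A) / d.P with hb
  obtain ⟨R, hR0, hR⟩ := d.exists_abs_rate_le ha0
  obtain ⟨Λ, hΛ0, hΛ⟩ := d.exists_val_le (half_pos ha0)
  have hval : ∀ lam ∈ d.simplex, ∀ mu, 0 < mu → d.val lam mu ≤ D₀ → mu ≤ b := by
    intro lam hl mu hm hv
    have h1 := hA lam hl mu
    have h2 := lag_le_val hl hm 0
    rw [hb, le_div_iff₀ hP]
    linarith
  have hb0 : 0 < b := hmu₀.trans_le (hval _ hl₀ _ hmu₀ le_rfl)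
  have hΛb : 0 ≤ 2 * Λ * (16 * d.c + 2 * b) := by positivity
  have hma : 0 ≤ 2 * ms / a := by positivity
  -- The summands ensure in turn that `mu` at most halves, that `rate + ρ ≥ ρ / 2`, that the
  -- smoothness error is at most `decr / 2`, and that the barrier estimate applies.
  refine ⟨a, b, d.P + 2 * R + 2 * Λ * (16 * d.c + 2 * b) + 2 * ms / a, ha0, by positivity,
    fun ρ hρ lam mu m hlam hmu hrun => ?_⟩
  have hPρ : d.P ≤ ρ := by linarith
  have hmsρ : 2 * ms ≤ a * ρ := by
    have : 2 * ms / a ≤ ρ := by linarith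
    rw [div_le_iff₀ ha0] at this
    linarith
  -- The run starts in the second alternative and may pass to the first. It never returns, because
  -- `val` does not increase.
  let Inv : (ι → ℝ) → ℝ → Prop := fun l u => l ∈ d.simplex ∧ 0 < u ∧ d.val l u ≤ D₀ ∧
    (d.val l u ≤ Ds + ε ∨ V u + C * d.val l u ≤ V mu₀ + C * D₀)
  have hmem : ∀ l u, Inv l u → a ≤ u := by
    rintro l u ⟨hl, hu, -, h1 | h1⟩
    · exact (min_le_left _ _).trans (hW.le_mu hl hu h1)
    · have h2 := h.val_le hl hu
      have h3 : C * Ds ≤ C * d.val l u := mul_le_mul_of_nonneg_left h2 hC0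
      have h4 : V u ≤ B := by rw [hB]; linarith
      refine (min_le_right _ _).trans ?_
      rw [← Real.le_log_iff_exp_le hu, div_le_iff₀ hms]
      simp only [hV] at h4
      linarith
  have hstep : ∀ t, Inv (lam t) (mu t) →
      (∀ k, 0 < d.rate (lam t) (mu t) k + ρ ∧ d.rate (lam t) (mu t) k ≤ ρ) ∧
      d.val (lam (t + 1)) (mu (t + 1)) ≤
        d.val (lam t) (mu t) - d.decr ρ (m t) (lam t) (mu t) / 2 ∧
      Inv (lam (t + 1)) (mu (t + 1)) := by
    intro t ht
    have hat := hmem _ _ ht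
    obtain ⟨hl, hu, hv, hor⟩ := ht
    have hrate : ∀ k, |d.rate (lam t) (mu t) k| ≤ R := hR _ hl _ hat
    have hrate1 : ∀ k, ρ / 2 ≤ d.rate (lam t) (mu t) k + ρ := fun k => by
      have := (abs_le.1 (hrate k)).1
      linarith
    have hrate2 : ∀ k, 0 < d.rate (lam t) (mu t) k + ρ ∧ d.rate (lam t) (mu t) k ≤ ρ :=
      fun k => ⟨by linarith [hrate1 k], by linarith [(abs_le.1 (hrate k)).2]⟩
    have hw := hrun.worst t
    have hv' := val_step_le ha0 hΛ0 hΛ hl hat (hval _ hl _ hu hv) hPρ (by linarith) hw hrate1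
    have hdec := decr_nonneg (m := m t) hl hu (fun k => (hrate2 k).1)
      (by linarith : 0 < d.P + ρ)
    rw [hrun.lam_succ, hrun.mu_succ]
    refine ⟨hrate2, hv', stepLam_mem hl hw fun k => (hrate2 k).1,
      lt_of_lt_of_le (half_pos hu) (half_le_stepMu hu hPρ), by linarith, ?_⟩
    by_cases hgap : ε ≤ d.val (lam t) (mu t) - Ds
    · rcases hor with h1 | h1
      · left; linarith
      · right
        have h2 := h.barrier_step_le ha0 hε0 hl hat hPρ hmsρ hw hrate2 hgap
        have h3 := mul_le_mul_of_nonneg_left hv' hC0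
        simp only [hV] at h1 ⊢
        linarith
    · left; linarith
  have hinv : ∀ t, Inv (lam t) (mu t) := by
    intro t
    induction t with
    | zero => exact ⟨hlam ▸ hl₀, hmu ▸ hmu₀, by rw [hlam, hmu], Or.inr (by rw [hlam, hmu])⟩
    | succ t ih => exact (hstep t ih).2.2
  intro t
  obtain ⟨h1, h2, -⟩ := hstep t (hinv t)
  obtain ⟨hl, hu, hv, -⟩ := hinv t
  exact ⟨hl, hmem _ _ (hinv t), hval _ hl _ hu hv, h1, h2⟩

/-- Both terms of `gap_le` are linear in deviations whose weighted squares make up `decr`. -/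
theorem IsSaddle.gap_le_sqrt (h : d.IsSaddle ls ms ys) {lam : ι → ℝ} {mu a b ρ : ℝ} {m : ι}
    (hl : lam ∈ d.simplex) (ha : 0 < a) (hmu : a ≤ mu) (hb : mu ≤ b) (hρ0 : 0 < ρ)
    (hm : ∀ k, d.rate lam mu m ≤ d.rate lam mu k)
    (hρ : ∀ k, 0 < d.rate lam mu k + ρ ∧ d.rate lam mu k ≤ ρ) :
    d.val lam mu - d.val ls ms ≤ √(2 * ρ * d.c * d.decr ρ m lam mu) +
      √((d.P + ρ) / a * d.decr ρ m lam mu) * (b + ms) := by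
  have hP := d.P_pos
  have hmu0 := ha.trans_le hmu
  have h1 := h.gap_le hl hm
  have h2 := Real.le_sqrt_of_sq_le (sq_sum_le_decr (m := m) hl hmu0 hρ0 hρ)
  have h3 : |d.P - d.pw lam mu| ≤ √((d.P + ρ) / a * d.decr ρ m lam mu) := by
    refine Real.le_sqrt_of_sq_le ?_
    have h4 : (d.pw lam mu - d.P) ^ 2 * mu / (d.P + ρ) ≤ d.decr ρ m lam mu :=
      le_add_of_nonneg_left (Finset.sum_nonneg fun k _ =>
        div_nonneg (mul_nonneg (sq_nonneg _) (hl.1 k)) (hρ k).1.le)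
    rw [div_le_iff₀ (by linarith)] at h4
    rw [sq_abs, div_mul_eq_mul_div, le_div_iff₀ ha]
    nlinarith [sq_nonneg (d.P - d.pw lam mu)]
  have h4 : (d.P - d.pw lam mu) * (mu - ms) ≤
      √((d.P + ρ) / a * d.decr ρ m lam mu) * (b + ms) := by
    refine (le_abs_self _).trans ?_
    rw [abs_mul]
    refine mul_le_mul h3 ?_ (abs_nonneg _) (Real.sqrt_nonneg _)
    have := h.pos
    rw [abs_le]
    constructor <;> linarith
  linarith

/-- The values decrease and are bounded below, so their differences and with them `decr` tend to
zero; `gap_le_sqrt` then identifies the limit. -/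
theorem IsSaddle.tendsto_val (h : d.IsSaddle ls ms ys) {lam : ℕ → ι → ℝ} {mu : ℕ → ℝ} {m : ℕ → ι}
    {a b ρ : ℝ} (ha : 0 < a) (hρ0 : 0 < ρ)
    (hw : ∀ t k, d.rate (lam t) (mu t) (m t) ≤ d.rate (lam t) (mu t) k)
    (hrun : ∀ t, lam t ∈ d.simplex ∧ a ≤ mu t ∧ mu t ≤ b ∧
        (∀ k, 0 < d.rate (lam t) (mu t) k + ρ ∧ d.rate (lam t) (mu t) k ≤ ρ) ∧
        d.val (lam (t + 1)) (mu (t + 1)) ≤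
          d.val (lam t) (mu t) - d.decr ρ (m t) (lam t) (mu t) / 2) :
    Filter.Tendsto (fun t => d.val (lam t) (mu t)) Filter.atTop (𝓝 (d.val ls ms)) := by
  have hP := d.P_pos
  have hge : ∀ t, d.val ls ms ≤ d.val (lam t) (mu t) := fun t =>
    h.val_le (hrun t).1 (ha.trans_le (hrun t).2.1)
  have hdec0 : ∀ t, 0 ≤ d.decr ρ (m t) (lam t) (mu t) := fun t =>
    decr_nonneg (hrun t).1 (ha.trans_le (hrun t).2.1) (fun k => ((hrun t).2.2.2.1 k).1)
      (by linarith)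
  have hanti : Antitone fun t => d.val (lam t) (mu t) :=
    antitone_nat_of_succ_le fun t => by
      have := (hrun t).2.2.2.2
      have := hdec0 t
      linarith
  have hlim := tendsto_atTop_ciInf hanti ⟨d.val ls ms, by rintro _ ⟨t, rfl⟩; exact hge t⟩
  have hdec : Filter.Tendsto (fun t => d.decr ρ (m t) (lam t) (mu t)) Filter.atTop (𝓝 0) := by
    have h1 := (hlim.sub (hlim.comp (Filter.tendsto_add_atTop_nat 1))).const_mul 2
    rw [sub_self, mul_zero] at h1
    refine squeeze_zero hdec0 (fun t => ?_) h1
    have := (hrun t).2.2.2.2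
    simp only [Function.comp]
    linarith
  have hgap : Filter.Tendsto (fun t => d.val (lam t) (mu t) - d.val ls ms) Filter.atTop (𝓝 0) := by
    have h1 : Filter.Tendsto (fun t => √(2 * ρ * d.c * d.decr ρ (m t) (lam t) (mu t)) +
        √((d.P + ρ) / a * d.decr ρ (m t) (lam t) (mu t)) * (b + ms)) Filter.atTop (𝓝 0) := by
      have h2 := (hdec.const_mul (2 * ρ * d.c)).sqrt
      have h3 := ((hdec.const_mul ((d.P + ρ) / a)).sqrt).mul_const (b + ms)
      simpa using h2.add h3
    refine squeeze_zero (fun t => sub_nonneg.2 (hge t)) (fun t => ?_) h1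
    obtain ⟨h1, h2, h3, h4, -⟩ := hrun t
    exact h.gap_le_sqrt h1 ha h2 h3 hρ0 (hw t) h4
  simpa using hgap.add_const (d.val ls ms)

theorem IsSaddle.tendsto_sol (h : d.IsSaddle ls ms ys) {lam : ℕ → ι → ℝ} {mu : ℕ → ℝ} {a : ℝ}
    (ha : 0 < a) (hmem : ∀ t, lam t ∈ d.simplex ∧ a ≤ mu t)
    (hv : Filter.Tendsto (fun t => d.val (lam t) (mu t)) Filter.atTop (𝓝 (d.val ls ms))) :
    Filter.Tendsto (fun t => d.sol (lam t) (mu t)) Filter.atTop (𝓝 (d.sol ls ms)) := by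
  rw [tendsto_iff_norm_sub_tendsto_zero]
  have h1 := ((hv.sub_const (d.val ls ms)).div_const a).sqrt
  rw [sub_self, zero_div, Real.sqrt_zero] at h1
  refine squeeze_zero (fun _ => norm_nonneg _) (fun t => ?_) h1
  obtain ⟨hl, hm⟩ := hmem t
  refine Real.le_sqrt_of_sq_le ?_
  have h2 := h.add_growth_le hl (ha.trans_le hm)
  rw [le_div_iff₀ ha, norm_sub_rev]
  nlinarith [sq_nonneg ‖d.sol ls ms - d.sol (lam t) (mu t)‖]

theorem IsSaddle.tendsto_rate (h : d.IsSaddle ls ms ys) {lam : ℕ → ι → ℝ} {mu : ℕ → ℝ}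
    {m : ℕ → ι} {a : ℝ} (ha : 0 < a) (hmem : ∀ t, lam t ∈ d.simplex ∧ a ≤ mu t)
    (hw : ∀ t k, d.rate (lam t) (mu t) (m t) ≤ d.rate (lam t) (mu t) k)
    (hs : Filter.Tendsto (fun t => d.sol (lam t) (mu t)) Filter.atTop (𝓝 (d.sol ls ms))) :
    Filter.Tendsto (fun t => d.rate (lam t) (mu t) (m t)) Filter.atTop (𝓝 ys) := by
  obtain ⟨R, hR0, hsol⟩ := d.exists_norm_sol_le (lt_min ha h.pos)
  obtain ⟨C, hC, hlip⟩ := d.lip R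
  have h1 := (tendsto_iff_norm_sub_tendsto_zero.1 hs).const_mul C
  rw [mul_zero] at h1
  rw [tendsto_iff_norm_sub_tendsto_zero]
  refine squeeze_zero (fun _ => norm_nonneg _) (fun t => ?_) h1
  have h2 : ∀ k, |d.rate (lam t) (mu t) k - d.rate ls ms k| ≤
      C * ‖d.sol (lam t) (mu t) - d.sol ls ms‖ := fun k =>
    hlip k _ _ (hsol ls h.mem ms (min_le_right _ _))
      (hsol _ (hmem t).1 _ ((min_le_left _ _).trans (hmem t).2))
  obtain ⟨k, hk⟩ := h.eq_rate
  rw [Real.norm_eq_abs, abs_le]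
  have h3 := abs_le.1 (h2 k)
  have h4 := abs_le.1 (h2 (m t))
  have h5 := hw t k
  have h6 := h.le_rate (m t)
  constructor <;> linarith

/-- Multipliers need not be unique, so only the distance to a set can converge. On the compact part
of the box at distance at least `ε` from `T`, `val` has a minimum strictly above the optimum, which
the run eventually undercuts. -/
theorem IsSaddle.tendsto_infDist (h : d.IsSaddle ls ms ys) {lam : ℕ → ι → ℝ} {mu : ℕ → ℝ}
    {a b : ℝ} (ha : 0 < a) (hmem : ∀ t, lam t ∈ d.simplex ∧ a ≤ mu t ∧ mu t ≤ b)
    (hv : Filter.Tendsto (fun t => d.val (lam t) (mu t)) Filter.atTop (𝓝 (d.val ls ms)))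
    {T : Set ((ι → ℝ) × ℝ)}
    (hT : ∀ l u, d.IsSaddle l u ys → d.sol l u = d.sol ls ms → (l, u) ∈ T) :
    Filter.Tendsto (fun t => Metric.infDist (lam t, mu t) T) Filter.atTop (𝓝 0) := by
  have hK : IsCompact (d.simplex ×ˢ Set.Icc a b) := d.isCompact_simplex.prod isCompact_Icc
  have hcont : ContinuousOn (fun x : (ι → ℝ) × ℝ => d.val x.1 x.2) (d.simplex ×ˢ Set.Icc a b) :=
    (d.continuousOn_val ha).mono fun x hx => ⟨hx.1, hx.2.1⟩
  rw [Metric.tendsto_atTop]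
  intro ε hε
  have hclosed : IsClosed {x : (ι → ℝ) × ℝ | ε ≤ Metric.infDist x T} :=
    isClosed_le continuous_const (Metric.continuous_infDist_pt T)
  have hKε := hK.inter_right hclosed
  suffices hs : ∀ᶠ t in Filter.atTop, Metric.infDist (lam t, mu t) T < ε by
    obtain ⟨N, hN⟩ := Filter.eventually_atTop.1 hs
    refine ⟨N, fun t ht => ?_⟩
    rw [Real.dist_eq, sub_zero, abs_of_nonneg Metric.infDist_nonneg]
    exact hN t ht
  rcases (d.simplex ×ˢ Set.Icc a b ∩ {x | ε ≤ Metric.infDist x T}).eq_empty_or_nonempty with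
    he | hne
  · refine Filter.Eventually.of_forall fun t => ?_
    by_contra! hlt
    have : (lam t, mu t) ∈ d.simplex ×ˢ Set.Icc a b ∩ {x | ε ≤ Metric.infDist x T} :=
      ⟨⟨(hmem t).1, (hmem t).2⟩, hlt⟩
    rw [he] at this
    exact this
  · obtain ⟨⟨l, u⟩, ⟨⟨hl, hu⟩, hd⟩, hmin⟩ :=
      hKε.exists_isMinOn hne (hcont.mono Set.inter_subset_left)
    simp only at hl hu
    have hu0 : 0 < u := ha.trans_le hu.1
    have hlt : d.val ls ms < d.val l u := by
      refine lt_of_le_of_ne (h.val_le hl hu0) fun heq => ?_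
      obtain ⟨h1, h2⟩ := h.of_val_eq hl hu0 heq.symm
      have h3 : Metric.infDist (l, u) T = 0 := Metric.infDist_zero_of_mem (hT l u h2 h1)
      have h4 : ε ≤ Metric.infDist (l, u) T := hd
      linarith
    filter_upwards [hv.eventually_lt_const hlt] with t ht
    by_contra! hge
    have := hmin (a := (lam t, mu t)) ⟨⟨(hmem t).1, (hmem t).2⟩, hge⟩
    exact absurd ht (not_lt.2 this)

end DualModel

/-! ### The beamforming problem with the Frobenius norm, whose square is the power. -/

namespace RSMA.Problem

section Frobenius

open scoped Matrix.Norms.Frobenius ComplexOrder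

variable {L K : ℕ} (p : RSMA.Problem L K)

theorem norm_sq_eq_sum (W : Beamformer L K) : ‖W‖ ^ 2 = ∑ j, ∑ l, ‖W l j‖ ^ 2 := by
  rw [Matrix.frobenius_norm_def, ← Real.sqrt_eq_rpow, Real.sq_sqrt
    (Finset.sum_nonneg fun _ _ => Finset.sum_nonneg fun _ _ => by positivity), Finset.sum_comm]
  simp

theorem power_eq (W : Beamformer L K) : power W = ‖W‖ ^ 2 := by
  rw [norm_sq_eq_sum, power, Matrix.trace, Complex.re_sum, Finset.sum_comm]
  refine Finset.sum_congr rfl fun l _ => ?_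
  rw [Matrix.diag_apply, Matrix.mul_apply, Complex.re_sum]
  refine Finset.sum_congr rfl fun j _ => ?_
  rw [Matrix.conjTranspose_apply, Complex.star_def, Complex.mul_conj, Complex.ofReal_re,
    Complex.normSq_eq_norm_sq]

theorem norm_entry_le (W : Beamformer L K) (l : Fin L) (j : Fin (K + 1)) : ‖W l j‖ ≤ ‖W‖ := by
  refine le_of_sq_le_sq ?_ (norm_nonneg _)
  rw [norm_sq_eq_sum]
  exact (Finset.single_le_sum (f := fun l => ‖W l j‖ ^ 2) (fun _ _ => by positivity)
    (Finset.mem_univ l)).trans (Finset.single_le_sum (f := fun j => ∑ l, ‖W l j‖ ^ 2)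
    (fun _ _ => Finset.sum_nonneg fun _ _ => by positivity) (Finset.mem_univ j))

theorem norm_add_sq (W V : Beamformer L K) : ‖W + V‖ ^ 2 =
    ‖W‖ ^ 2 + 2 * ∑ j, (star (W.col j) ⬝ᵥ V.col j).re + ‖V‖ ^ 2 := by
  simp only [norm_sq_eq_sum, Finset.mul_sum, ← Finset.sum_add_distrib]
  refine Finset.sum_congr rfl fun j _ => ?_
  rw [dotProduct, Complex.re_sum, Finset.mul_sum]
  simp only [← Finset.sum_add_distrib]
  refine Finset.sum_congr rfl fun l _ => ?_
  simp only [Matrix.add_apply, Complex.sq_norm, Complex.normSq_apply, Complex.add_re,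
    Complex.add_im, Pi.star_apply, Matrix.col_apply, Complex.star_def, Complex.mul_re,
    Complex.conj_re, Complex.conj_im]
  ring

theorem gain_add (W V : Beamformer L K) (k : Fin K) (j : Fin (K + 1)) :
    p.gain (W + V) k j = p.gain W k j + p.gain V k j := by
  rw [gain, gain, gain, ← dotProduct_add]
  rfl

theorem gain_sub (W V : Beamformer L K) (k : Fin K) (j : Fin (K + 1)) :
    p.gain (W - V) k j = p.gain W k j - p.gain V k j := by
  rw [gain, gain, gain, ← dotProduct_sub]
  rfl

theorem norm_gain_le (W : Beamformer L K) (k : Fin K) (j : Fin (K + 1)) :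
    ‖p.gain W k j‖ ≤ (∑ l, ‖p.h k l‖) * ‖W‖ := by
  rw [gain, dotProduct, Finset.sum_mul]
  refine (norm_sum_le _ _).trans (Finset.sum_le_sum fun l _ => ?_)
  rw [norm_mul, Pi.star_apply, norm_star]
  exact mul_le_mul_of_nonneg_left (norm_entry_le W l j) (norm_nonneg _)

theorem gc_add (W V : Beamformer L K) (k : Fin K) : p.gc k (W + V) = p.gc k W +
    2 * (√(1 + p.αc k) * (star (p.βc k) * p.gain V k 0).re) -
    ‖p.βc k‖ ^ 2 * (2 * ∑ j, (star (p.gain W k j) * p.gain V k j).re +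
      ∑ j, ‖p.gain V k j‖ ^ 2) := by
  have h : ∑ j, ‖p.gain W k j + p.gain V k j‖ ^ 2 = ∑ j, ‖p.gain W k j‖ ^ 2 +
      (2 * ∑ j, (star (p.gain W k j) * p.gain V k j).re + ∑ j, ‖p.gain V k j‖ ^ 2) := by
    rw [Finset.mul_sum, ← Finset.sum_add_distrib, ← Finset.sum_add_distrib]
    refine Finset.sum_congr rfl fun j _ => ?_
    simp only [Complex.sq_norm, Complex.normSq_apply, Complex.add_re, Complex.add_im,
      Complex.star_def, Complex.mul_re, Complex.conj_re, Complex.conj_im]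
    ring
  simp only [gc, gain_add, h, mul_add, Complex.add_re]
  ring

theorem gp_add (W V : Beamformer L K) (k : Fin K) : p.gp k (W + V) = p.gp k W +
    2 * (√(1 + p.αp k) * (star (p.βp k) * p.gain V k k.succ).re) -
    ‖p.βp k‖ ^ 2 * (2 * ∑ j : Fin K, (star (p.gain W k j.succ) * p.gain V k j.succ).re +
      ∑ j : Fin K, ‖p.gain V k j.succ‖ ^ 2) := by
  have h : ∑ j : Fin K, ‖p.gain W k j.succ + p.gain V k j.succ‖ ^ 2 =
      ∑ j : Fin K, ‖p.gain W k j.succ‖ ^ 2 +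
      (2 * ∑ j : Fin K, (star (p.gain W k j.succ) * p.gain V k j.succ).re +
        ∑ j : Fin K, ‖p.gain V k j.succ‖ ^ 2) := by
    rw [Finset.mul_sum, ← Finset.sum_add_distrib, ← Finset.sum_add_distrib]
    refine Finset.sum_congr rfl fun j _ => ?_
    simp only [Complex.sq_norm, Complex.normSq_apply, Complex.add_re, Complex.add_im,
      Complex.star_def, Complex.mul_re, Complex.conj_re, Complex.conj_im]
    ring
  simp only [gp, gain_add, h, mul_add, Complex.add_re]
  ring

/-- Completing the square in `x = Re (star β * g)`, as `x ^ 2 ≤ ‖β‖ ^ 2 * ‖g‖ ^ 2`. It bounds the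
transformed rates from above. -/
theorem two_mul_re_sub_le (a : ℝ) (β g : ℂ) {s : ℝ} (hs : ‖g‖ ^ 2 ≤ s) :
    2 * a * (star β * g).re - ‖β‖ ^ 2 * s ≤ a ^ 2 := by
  have h1 : ‖β‖ ^ 2 * ‖g‖ ^ 2 = ‖star β * g‖ ^ 2 := by rw [norm_mul, norm_star, mul_pow]
  have h2 : (star β * g).re ^ 2 ≤ ‖star β * g‖ ^ 2 := by
    rw [Complex.sq_norm, Complex.normSq_apply]
    nlinarith [sq_nonneg (star β * g).im]
  have h3 := mul_le_mul_of_nonneg_left hs (sq_nonneg ‖β‖)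
  nlinarith [sq_nonneg (a - (star β * g).re)]

theorem gc_le (k : Fin K) (W : Beamformer L K) : p.gc k W ≤
    √(1 + p.αc k) ^ 2 - p.αc k - ‖p.βc k‖ ^ 2 * p.noise k + Real.log (1 + p.αc k) := by
  have h := two_mul_re_sub_le √(1 + p.αc k) (p.βc k) (p.gain W k 0)
    (s := ∑ j, ‖p.gain W k j‖ ^ 2)
    (Finset.single_le_sum (f := fun j => ‖p.gain W k j‖ ^ 2) (fun _ _ => by positivity)
      (Finset.mem_univ 0))
  rw [gc]
  linarith

theorem gp_le (k : Fin K) (W : Beamformer L K) : p.gp k W ≤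
    √(1 + p.αp k) ^ 2 - p.αp k - ‖p.βp k‖ ^ 2 * p.noise k + Real.log (1 + p.αp k) := by
  have h := two_mul_re_sub_le √(1 + p.αp k) (p.βp k) (p.gain W k k.succ)
    (s := ∑ j : Fin K, ‖p.gain W k j.succ‖ ^ 2)
    (Finset.single_le_sum (f := fun j : Fin K => ‖p.gain W k j.succ‖ ^ 2)
      (fun _ _ => by positivity) (Finset.mem_univ k))
  rw [gp]
  linarith

theorem exists_lipschitz_gc (R : ℝ) (k : Fin K) : ∃ C : ℝ, 0 ≤ C ∧ ∀ W W' : Beamformer L K,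
    ‖W‖ ≤ R → ‖W'‖ ≤ R → |p.gc k W' - p.gc k W| ≤ C * ‖W' - W‖ := by
  set η := ∑ l, ‖p.h k l‖ with hη
  have hη0 : 0 ≤ η := Finset.sum_nonneg fun _ _ => norm_nonneg _
  refine ⟨2 * √(1 + p.αc k) * (‖p.βc k‖ * η) +
    ‖p.βc k‖ ^ 2 * ∑ _j : Fin (K + 1), η * (2 * |R|) * η, by positivity,
    fun W W' hW hW' => ?_⟩
  have hW1 : ‖W‖ ≤ |R| := hW.trans (le_abs_self R)
  have hW2 : ‖W'‖ ≤ |R| := hW'.trans (le_abs_self R)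
  have h1 : p.gc k W' - p.gc k W =
      2 * √(1 + p.αc k) * (star (p.βc k) * p.gain (W' - W) k 0).re -
      ‖p.βc k‖ ^ 2 * ∑ j, (‖p.gain W' k j‖ ^ 2 - ‖p.gain W k j‖ ^ 2) := by
    simp only [gc, gain_sub, mul_sub, Complex.sub_re, Finset.sum_sub_distrib]
    ring
  have h2 : |(star (p.βc k) * p.gain (W' - W) k 0).re| ≤ ‖p.βc k‖ * η * ‖W' - W‖ := by
    refine (Complex.abs_re_le_norm _).trans ?_
    rw [norm_mul, norm_star, mul_assoc]
    exact mul_le_mul_of_nonneg_left (p.norm_gain_le _ k 0) (norm_nonneg _)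
  have h3 : |∑ j, (‖p.gain W' k j‖ ^ 2 - ‖p.gain W k j‖ ^ 2)| ≤
      (∑ _j : Fin (K + 1), η * (2 * |R|) * η) * ‖W' - W‖ := by
    rw [Finset.sum_mul]
    refine (Finset.abs_sum_le_sum_abs _ _).trans (Finset.sum_le_sum fun j _ => ?_)
    rw [sq_sub_sq, abs_mul, abs_of_nonneg (by positivity), mul_assoc]
    refine mul_le_mul ?_ ?_ (abs_nonneg _) (by positivity)
    · have e1 := p.norm_gain_le W k j
      have e2 := p.norm_gain_le W' k j
      have e3 := mul_le_mul_of_nonneg_left hW1 hη0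
      have e4 := mul_le_mul_of_nonneg_left hW2 hη0
      linarith
    · refine (abs_norm_sub_norm_le _ _).trans ?_
      rw [← gain_sub]
      exact p.norm_gain_le _ k j
  rw [h1]
  refine (abs_sub _ _).trans ?_
  rw [abs_mul (2 * √(1 + p.αc k)), abs_mul (‖p.βc k‖ ^ 2),
    abs_of_nonneg (by positivity : 0 ≤ 2 * √(1 + p.αc k)),
    abs_of_nonneg (by positivity : 0 ≤ ‖p.βc k‖ ^ 2)]
  have e1 := mul_le_mul_of_nonneg_left h2 (by positivity : 0 ≤ 2 * √(1 + p.αc k))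
  have e2 := mul_le_mul_of_nonneg_left h3 (by positivity : 0 ≤ ‖p.βc k‖ ^ 2)
  linarith

theorem star_H_mulVec_dotProduct (x : Fin K → ℂ) (v : Fin L → ℂ) :
    star (p.H *ᵥ x) ⬝ᵥ v = ∑ k, star (x k) * (star (p.h k) ⬝ᵥ v) := by
  simp only [dotProduct, Matrix.mulVec, Pi.star_apply, star_sum, Finset.sum_mul, Finset.mul_sum,
    star_mul', H, Matrix.of_apply]
  rw [Finset.sum_comm]
  exact Finset.sum_congr rfl fun k _ => Finset.sum_congr rfl fun l _ => by ring

theorem star_gram_mulVec_dotProduct (θ : Fin K → ℝ) (mu : ℝ) (w v : Fin L → ℂ) :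
    star ((p.H * Matrix.diagonal (fun j => (θ j : ℂ)) * p.Hᴴ + (mu : ℂ) • 1) *ᵥ w) ⬝ᵥ v =
      ∑ k, (θ k : ℂ) * (star (star (p.h k) ⬝ᵥ w) * (star (p.h k) ⬝ᵥ v)) +
        mu * (star w ⬝ᵥ v) := by
  have h : (p.H * Matrix.diagonal (fun j => (θ j : ℂ)) * p.Hᴴ + (mu : ℂ) • 1) *ᵥ w =
      p.H *ᵥ (fun k => (θ k : ℂ) * (star (p.h k) ⬝ᵥ w)) + (mu : ℂ) • w := by
    rw [Matrix.add_mulVec, Matrix.smul_mulVec, Matrix.one_mulVec, ← Matrix.mulVec_mulVec,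
      ← Matrix.mulVec_mulVec]
    congr 2
    ext k
    rw [Matrix.mulVec_diagonal]
    rfl
  rw [h, star_add, add_dotProduct, star_H_mulVec_dotProduct, star_smul, smul_dotProduct]
  congr 1
  · refine Finset.sum_congr rfl fun k _ => ?_
    rw [star_mul', Complex.star_def, Complex.conj_ofReal, mul_assoc]
  · rw [Complex.star_def, Complex.conj_ofReal, smul_eq_mul]

theorem isUnit_gram {θ : Fin K → ℝ} (hθ : ∀ k, 0 ≤ θ k) {mu : ℝ} (hmu : 0 < mu) :
    IsUnit (p.H * Matrix.diagonal (fun j => (θ j : ℂ)) * p.Hᴴ + (mu : ℂ) • 1).det := by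
  have h1 : (Matrix.diagonal (fun j => (θ j : ℂ))).PosSemidef :=
    Matrix.PosSemidef.diagonal fun k => by simpa using hθ k
  have h2 : ((mu : ℂ) • (1 : Matrix (Fin L) (Fin L) ℂ)).PosDef :=
    Matrix.PosDef.one.smul (by simpa using hmu)
  exact (Matrix.isUnit_iff_isUnit_det _).1
    (h2.posSemidef_add (h1.mul_mul_conjTranspose_same p.H)).isUnit

variable {p} {lam : Fin K → ℝ} {mu : ℝ}

theorem Mc_mulVec_beam (hl : ∀ k, 0 ≤ lam k) (hmu : 0 < mu) :
    p.Mc lam mu *ᵥ (p.beam lam mu).col 0 = p.H *ᵥ p.dc lam := by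
  have h : IsUnit (p.Mc lam mu).det :=
    p.isUnit_gram (fun k => mul_nonneg (hl k) (sq_nonneg _)) hmu
  have h2 : (p.beam lam mu).col 0 = (p.Mc lam mu)⁻¹ *ᵥ (p.H *ᵥ p.dc lam) := rfl
  rw [h2, Matrix.mulVec_mulVec, Matrix.mul_nonsing_inv _ h, Matrix.one_mulVec]

theorem Mp_mulVec_beam (hδ : ∀ k, 0 ≤ p.δ k) (hl : ∀ k, 0 ≤ lam k) (hmu : 0 < mu) (k : Fin K) :
    p.Mp lam mu *ᵥ (p.beam lam mu).col k.succ = p.dp k • p.h k := by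
  have h : IsUnit (p.Mp lam mu).det :=
    p.isUnit_gram (fun k => add_nonneg (mul_nonneg (hδ k) (sq_nonneg _))
      (mul_nonneg (hl k) (sq_nonneg _))) hmu
  have h2 : (p.beam lam mu).col k.succ = p.dp k • ((p.Mp lam mu)⁻¹ *ᵥ p.h k) := rfl
  rw [h2, Matrix.mulVec_smul, Matrix.mulVec_mulVec, Matrix.mul_nonsing_inv _ h,
    Matrix.one_mulVec]

/-- The linear equation defining column `0`, paired with a perturbation: the first-order terms of
the Lagrangian in that column cancel. -/
theorem stationary_common (hl : ∀ k, 0 ≤ lam k) (hmu : 0 < mu) (V : Beamformer L K) :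
    ∑ k, lam k * (√(1 + p.αc k) * (star (p.βc k) * p.gain V k 0).re) =
      ∑ k, lam k * ‖p.βc k‖ ^ 2 *
        (star (p.gain (p.beam lam mu) k 0) * p.gain V k 0).re +
      mu * (star ((p.beam lam mu).col 0) ⬝ᵥ V.col 0).re := by
  have h := congrArg (fun x => (star x ⬝ᵥ V.col 0).re) (Mc_mulVec_beam (p := p) hl hmu)
  simp only [Mc, star_gram_mulVec_dotProduct, star_H_mulVec_dotProduct] at h
  rw [Complex.add_re, Complex.re_sum, Complex.re_sum, Complex.re_ofReal_mul] at h
  simp only [Complex.re_ofReal_mul, θc] at h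
  simp only [gain]
  rw [h]
  refine Finset.sum_congr rfl fun k _ => ?_
  rw [← Complex.re_ofReal_mul, ← Complex.re_ofReal_mul]
  congr 1
  simp only [dc, star_mul', Complex.star_def, Complex.conj_ofReal]
  ring

theorem stationary_private (hδ : ∀ k, 0 ≤ p.δ k) (hl : ∀ k, 0 ≤ lam k) (hmu : 0 < mu)
    (V : Beamformer L K) (j : Fin K) :
    p.δ j * (√(1 + p.αp j) * (star (p.βp j) * p.gain V j j.succ).re) =
      ∑ k, (p.δ k * ‖p.βp k‖ ^ 2 + lam k * ‖p.βc k‖ ^ 2) *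
        (star (p.gain (p.beam lam mu) k j.succ) * p.gain V k j.succ).re +
      mu * (star ((p.beam lam mu).col j.succ) ⬝ᵥ V.col j.succ).re := by
  have h := congrArg (fun x => (star x ⬝ᵥ V.col j.succ).re) (Mp_mulVec_beam (p := p) hδ hl hmu j)
  simp only [Mp, star_gram_mulVec_dotProduct, star_smul, smul_dotProduct, smul_eq_mul] at h
  rw [Complex.add_re, Complex.re_sum, Complex.re_ofReal_mul] at h
  simp only [Complex.re_ofReal_mul, θp] at h
  simp only [gain]
  rw [h, ← Complex.re_ofReal_mul, ← Complex.re_ofReal_mul]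
  congr 1
  simp only [dp, star_mul', Complex.star_def, Complex.conj_ofReal]
  ring

/-- The Lagrangian equals its second-order expansion at `beam`. The linear part vanishes by
stationarity; the quadratic part is `-mu * ‖V‖ ^ 2` minus nonnegative gain terms. -/
theorem growth (hδ : ∀ k, 0 ≤ p.δ k) (hl : ∀ k, 0 ≤ lam k) (hmu : 0 < mu) (W : Beamformer L K) :
    ∑ k, p.δ k * p.gp k W + ∑ k, lam k * p.gc k W - mu * (‖W‖ ^ 2 - p.Pt) +
        mu * ‖W - p.beam lam mu‖ ^ 2 ≤
      ∑ k, p.δ k * p.gp k (p.beam lam mu) + ∑ k, lam k * p.gc k (p.beam lam mu) -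
        mu * (‖p.beam lam mu‖ ^ 2 - p.Pt) := by
  obtain ⟨V, rfl⟩ : ∃ V, W = p.beam lam mu + V := ⟨W - p.beam lam mu, by abel⟩
  rw [add_sub_cancel_left, norm_add_sq, Fin.sum_univ_succ]
  have hc := stationary_common (p := p) hl hmu V
  have hp := Finset.sum_congr rfl fun j (_ : j ∈ Finset.univ) =>
    stationary_private (p := p) hδ hl hmu V j
  set B := p.beam lam mu with hB
  -- Stationarity is summed over streams, the rates over users; the double sum is exchanged to
  -- match.
  rw [Finset.sum_add_distrib, ← Finset.mul_sum, Finset.sum_comm] at hp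
  have e1 : ∑ k, lam k * p.gc k (B + V) = ∑ k, lam k * p.gc k B +
      2 * ∑ k, lam k * (√(1 + p.αc k) * (star (p.βc k) * p.gain V k 0).re) -
      2 * ∑ k, lam k * ‖p.βc k‖ ^ 2 * (star (p.gain B k 0) * p.gain V k 0).re -
      2 * ∑ k, lam k * ‖p.βc k‖ ^ 2 *
        ∑ j : Fin K, (star (p.gain B k j.succ) * p.gain V k j.succ).re -
      ∑ k, lam k * ‖p.βc k‖ ^ 2 * ∑ j, ‖p.gain V k j‖ ^ 2 := by
    simp only [Finset.mul_sum, ← Finset.sum_add_distrib, ← Finset.sum_sub_distrib]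
    refine Finset.sum_congr rfl fun k _ => ?_
    simp only [← Finset.mul_sum]
    rw [gc_add, Fin.sum_univ_succ (fun j => (star (p.gain B k j) * p.gain V k j).re)]
    ring
  have e2 : ∑ k, p.δ k * p.gp k (B + V) = ∑ k, p.δ k * p.gp k B +
      2 * ∑ k, p.δ k * (√(1 + p.αp k) * (star (p.βp k) * p.gain V k k.succ).re) -
      2 * ∑ k, p.δ k * ‖p.βp k‖ ^ 2 *
        ∑ j : Fin K, (star (p.gain B k j.succ) * p.gain V k j.succ).re -
      ∑ k, p.δ k * ‖p.βp k‖ ^ 2 * ∑ j : Fin K, ‖p.gain V k j.succ‖ ^ 2 := by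
    simp only [Finset.mul_sum, ← Finset.sum_add_distrib, ← Finset.sum_sub_distrib]
    refine Finset.sum_congr rfl fun k _ => ?_
    simp only [← Finset.mul_sum]
    rw [gp_add]
    ring
  have e3 : ∑ k, ∑ j : Fin K, (p.δ k * ‖p.βp k‖ ^ 2 + lam k * ‖p.βc k‖ ^ 2) *
        (star (p.gain B k j.succ) * p.gain V k j.succ).re =
      ∑ k, p.δ k * ‖p.βp k‖ ^ 2 *
        ∑ j : Fin K, (star (p.gain B k j.succ) * p.gain V k j.succ).re +
      ∑ k, lam k * ‖p.βc k‖ ^ 2 *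
        ∑ j : Fin K, (star (p.gain B k j.succ) * p.gain V k j.succ).re := by
    rw [← Finset.sum_add_distrib]
    refine Finset.sum_congr rfl fun k _ => ?_
    rw [← Finset.mul_sum, add_mul]
  have e4 : 0 ≤ ∑ k, lam k * ‖p.βc k‖ ^ 2 * ∑ j, ‖p.gain V k j‖ ^ 2 :=
    Finset.sum_nonneg fun k _ => mul_nonneg (mul_nonneg (hl k) (sq_nonneg _))
      (Finset.sum_nonneg fun _ _ => sq_nonneg _)
  have e5 : 0 ≤ ∑ k, p.δ k * ‖p.βp k‖ ^ 2 * ∑ j : Fin K, ‖p.gain V k j.succ‖ ^ 2 :=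
    Finset.sum_nonneg fun k _ => mul_nonneg (mul_nonneg (hδ k) (sq_nonneg _))
      (Finset.sum_nonneg fun _ _ => sq_nonneg _)
  rw [e3] at hp
  rw [e1, e2]
  linarith

/-! ### The abstract model applied: primal optimum, saddle point and KKT conditions. -/

variable (p)

theorem δmax_nonneg (hδ : ∀ k, 0 ≤ p.δ k) : 0 ≤ p.δmax := Real.iSup_nonneg hδ

/-- The Lagrangian model of the beamforming subproblem. -/
noncomputable def model (hδ : ∀ k, 0 ≤ p.δ k) (hPt : 0 < p.Pt) :
    DualModel (Fin K) (Beamformer L K) where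
  F W := ∑ k, p.δ k * p.gp k W
  G := p.gc
  c := p.δmax
  P := p.Pt
  sol := p.beam
  c_nonneg := p.δmax_nonneg hδ
  P_pos := hPt
  bound := by
    let b : Fin K → ℝ := fun k =>
      √(1 + p.αc k) ^ 2 - p.αc k - ‖p.βc k‖ ^ 2 * p.noise k + Real.log (1 + p.αc k)
    let b' : Fin K → ℝ := fun k =>
      √(1 + p.αp k) ^ 2 - p.αp k - ‖p.βp k‖ ^ 2 * p.noise k + Real.log (1 + p.αp k)
    refine ⟨∑ k, p.δ k * |b' k| + ∑ k, |b k|, fun W => ?_, fun k W => ?_⟩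
    · have h1 : 0 ≤ ∑ k, |b k| := Finset.sum_nonneg fun _ _ => abs_nonneg _
      have h2 : ∑ k, p.δ k * p.gp k W ≤ ∑ k, p.δ k * |b' k| :=
        Finset.sum_le_sum fun k _ =>
          mul_le_mul_of_nonneg_left ((p.gp_le k W).trans (le_abs_self _)) (hδ k)
      linarith
    · have h1 : 0 ≤ ∑ k, p.δ k * |b' k| :=
        Finset.sum_nonneg fun k _ => mul_nonneg (hδ k) (abs_nonneg _)
      have h2 : |b k| ≤ ∑ k, |b k| :=
        Finset.single_le_sum (f := fun k => |b k|) (fun _ _ => abs_nonneg _) (Finset.mem_univ k)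
      have h3 : p.gc k W ≤ |b k| := (p.gc_le k W).trans (le_abs_self _)
      linarith
  lip R := by
    choose C hC h using p.exists_lipschitz_gc R
    refine ⟨∑ k, C k, Finset.sum_nonneg fun k _ => hC k, fun k W W' hW hW' => ?_⟩
    refine (h k W W' hW hW').trans (mul_le_mul_of_nonneg_right ?_ (norm_nonneg _))
    exact Finset.single_le_sum (fun k _ => hC k) (Finset.mem_univ k)
  growth _ _ hl hmu W := growth hδ hl hmu W

theorem continuous_gain (k : Fin K) (j : Fin (K + 1)) :
    Continuous fun W : Beamformer L K => p.gain W k j := by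
  unfold gain dotProduct
  simp only [Matrix.col_apply]
  fun_prop

theorem continuous_gc (k : Fin K) : Continuous (p.gc k) := by
  have := p.continuous_gain k
  unfold gc
  fun_prop

theorem continuous_gp (k : Fin K) : Continuous (p.gp k) := by
  have := p.continuous_gain k
  unfold gp
  fun_prop

theorem exists_feasible [NeZero K] (hPt : 0 < p.Pt) :
    ∃ (W : Beamformer L K) (y : ℝ), p.Feasible W y := by
  obtain ⟨k, hk⟩ := Finite.exists_min fun k => p.gc k 0
  exact ⟨0, p.gc k 0, hk, by rw [power_eq]; simpa using hPt.le⟩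

/-- For given `W` the best `y` is the minimum of the common rates, which leaves a continuous
function on a compact ball. -/
theorem exists_isOptimal [NeZero K] (hδ : ∀ k, 0 ≤ p.δ k) (hPt : 0 < p.Pt) :
    ∃ (W : Beamformer L K) (y : ℝ), p.IsOptimal W y := by
  have : ProperSpace (Beamformer L K) := FiniteDimensional.proper ℂ _
  have hne : (Finset.univ : Finset (Fin K)).Nonempty := Finset.univ_nonempty
  have hcont : Continuous fun W : Beamformer L K =>
      p.objective W (Finset.univ.inf' hne fun k => p.gc k W) := by
    have h1 := p.continuous_gp
    have h2 : Continuous fun W : Beamformer L K => Finset.univ.inf' hne fun k => p.gc k W :=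
      Continuous.finset_inf'_apply hne fun k _ => p.continuous_gc k
    unfold objective
    fun_prop
  obtain ⟨W, hW, hmax⟩ := (isCompact_closedBall (0 : Beamformer L K) √p.Pt).exists_isMaxOn
    ⟨0, by simp⟩ hcont.continuousOn
  have hball : ∀ W : Beamformer L K, W ∈ Metric.closedBall 0 √p.Pt ↔ power W ≤ p.Pt := by
    intro W
    rw [mem_closedBall_zero_iff, power_eq, Real.le_sqrt (norm_nonneg _) hPt.le]
  refine ⟨W, _, ⟨fun k => Finset.inf'_le _ (Finset.mem_univ k), (hball W).1 hW⟩,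
    fun W' y' hf => le_trans ?_ (hmax ((hball W').2 hf.2))⟩
  have h1 : y' ≤ Finset.univ.inf' hne fun k => p.gc k W' :=
    Finset.le_inf' _ _ fun k _ => hf.1 k
  have h2 := mul_le_mul_of_nonneg_left h1 (p.δmax_nonneg hδ)
  simp only [objective]
  linarith

variable {p}

/-- Otherwise all weights vanish and the objective is constantly zero. Positivity makes the optimal
`y` unique. -/
theorem PowerBinding.δmax_pos [NeZero K] (h : p.PowerBinding) (hδ : ∀ k, 0 ≤ p.δ k)
    (hPt : 0 < p.Pt) : 0 < p.δmax := by
  refine lt_of_le_of_ne (p.δmax_nonneg hδ) fun h0 => ?_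
  have hz : ∀ k, p.δ k = 0 := fun k =>
    le_antisymm ((le_ciSup (Set.finite_range p.δ).bddAbove k).trans h0.ge) (hδ k)
  obtain ⟨W, y, -, hlt⟩ := h
  obtain ⟨W', y', hf⟩ := p.exists_feasible hPt
  have := hlt W' y' hf
  simp [objective, hz, ← h0] at this

theorem isKKT_of_isSaddle {hδ : ∀ k, 0 ≤ p.δ k} {hPt : 0 < p.Pt} {ls : Fin K → ℝ} {ms ys : ℝ}
    (h : (p.model hδ hPt).IsSaddle ls ms ys) : p.IsKKT (p.beam ls ms) ys ls ms where
  stat_common := Mc_mulVec_beam h.mem.1 h.pos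
  stat_private := Mp_mulVec_beam hδ h.mem.1 h.pos
  stat_y := h.mem.2.symm
  slack_rate := h.slack
  slack_power := by
    have : power (p.beam ls ms) = p.Pt := (power_eq _).trans h.pw_eq
    rw [this, sub_self, mul_zero]
  primal := ⟨h.le_rate, ((power_eq _).trans h.pw_eq).le⟩
  lam_nonneg := h.mem.1
  mu_nonneg := h.pos.le

theorem IsHFPI.isRun {hδ : ∀ k, 0 ≤ p.δ k} {hPt : 0 < p.Pt} {ρ : ℝ} {lam : ℕ → Fin K → ℝ}
    {mu : ℕ → ℝ} {m : ℕ → Fin K} (h : p.IsHFPI ρ lam mu m) :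
    (p.model hδ hPt).IsRun ρ lam mu m where
  worst := h.worst
  lam_succ := h.lam_succ
  mu_succ t := by
    rw [h.mu_succ, nextMu, power_eq]
    rfl

/-- The primal solution belongs to a saddle point of the Lagrangian, and it is unique. -/
theorem PowerBinding.exists_isSaddle [NeZero K] (hbind : p.PowerBinding) (hδ : ∀ k, 0 ≤ p.δ k)
    (hPt : 0 < p.Pt) : ∃ ls ms ys, (p.model hδ hPt).IsSaddle ls ms ys ∧
      p.IsOptimal (p.beam ls ms) ys ∧
      (∀ W y, p.IsOptimal W y → W = p.beam ls ms ∧ y = ys) ∧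
      ∃ κ W y, 0 < κ ∧ (p.model hδ hPt).Exceeds ((p.model hδ hPt).val ls ms) κ W y := by
  set d := p.model hδ hPt with hd
  have hobj : ∀ W y, p.objective W y = d.F W + d.c * y := fun W y => add_comm _ _
  have hfeas : ∀ W y, p.Feasible W y ↔ (∀ k, y ≤ d.G k W) ∧ ‖W‖ ^ 2 ≤ d.P := fun W y => by
    rw [Feasible, power_eq]
    rfl
  have hδpos := hbind.δmax_pos hδ hPt
  obtain ⟨Wb, yb, hWb, hlt⟩ := hbind
  obtain ⟨W₁, y₁, hf₁, hmax₁⟩ := p.exists_isOptimal hδ hPt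
  have hκ : 0 < p.objective Wb yb - p.objective W₁ y₁ := sub_pos.2 (hlt W₁ y₁ hf₁)
  have hexc : d.Exceeds (p.objective W₁ y₁) (p.objective Wb yb - p.objective W₁ y₁) Wb yb :=
    ⟨hWb, by rw [← hobj]; linarith⟩
  obtain ⟨ls, ms, ys, hs⟩ := DualModel.exists_isSaddle hκ hexc fun W' y' h1 h2 => by
    rw [← hobj]
    exact hmax₁ W' y' ((hfeas W' y').2 ⟨h1, h2⟩)
  have hprimal : ∀ W y, p.Feasible W y →
      p.objective W y + ms * ‖W - p.beam ls ms‖ ^ 2 ≤ p.objective (p.beam ls ms) ys := by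
    intro W y hf
    rw [hobj, hobj]
    exact hs.primal_le ((hfeas W y).1 hf).1 ((hfeas W y).1 hf).2
  have hms := hs.pos
  have hopt : p.IsOptimal (p.beam ls ms) ys := by
    refine ⟨(isKKT_of_isSaddle hs).primal, fun W y hf => ?_⟩
    have h1 := hprimal W y hf
    have h2 : 0 ≤ ms * ‖W - p.beam ls ms‖ ^ 2 := by positivity
    linarith
  -- Strong duality: the excess over the primal optimum is also an excess over the minimum of the
  -- dual function.
  have hval : d.val ls ms = p.objective W₁ y₁ := by
    rw [hs.val_eq]
    refine le_antisymm ?_ ?_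
    · have := hmax₁ _ _ hopt.1
      rwa [hobj (p.beam ls ms)] at this
    · have := hopt.2 _ _ hf₁
      rwa [hobj (p.beam ls ms)] at this
  refine ⟨ls, ms, ys, hs, hopt, fun W y h => ?_, _, Wb, yb, hκ, by rw [hval]; exact hexc⟩
  have h1 := hprimal W y h.1
  have h2 := h.2 _ _ hopt.1
  have h3 : ‖W - p.beam ls ms‖ ^ 2 ≤ 0 := by
    by_contra! h4
    nlinarith [mul_pos hms h4]
  have h5 : W = p.beam ls ms := by
    have h6 : ‖W - p.beam ls ms‖ = 0 := by
      rw [← sq_eq_zero_iff]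
      exact le_antisymm h3 (sq_nonneg _)
    exact sub_eq_zero.1 (norm_eq_zero.1 h6)
  refine ⟨h5, ?_⟩
  have h6 : p.objective W y = p.objective (p.beam ls ms) ys :=
    le_antisymm (hopt.2 _ _ h.1) h2
  rw [h5] at h6
  simp only [objective] at h6
  exact mul_left_cancel₀ hδpos.ne' (add_right_cancel h6)

end Frobenius

end RSMA.Problem

/-! ### The convergence theorem. -/

theorem proposition7 {L K : ℕ} [NeZero K] (p : RSMA.Problem L K)
    (hnoise : ∀ k, 0 < p.noise k) (hδ : ∀ k, 0 ≤ p.δ k) (hPt : 0 < p.Pt)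
    (hαc : ∀ k, 0 ≤ p.αc k) (hαp : ∀ k, 0 ≤ p.αp k) (hbind : p.PowerBinding) :
    ∃ (Wopt : RSMA.Beamformer L K) (yopt : ℝ),
      p.IsOptimal Wopt yopt ∧
      (∀ W y, p.IsOptimal W y → W = Wopt ∧ y = yopt) ∧
      {x : (Fin K → ℝ) × ℝ | p.IsKKT Wopt yopt x.1 x.2}.Nonempty ∧
      ∀ lam₀ ∈ p.hyperplane, ∀ mu₀ : ℝ, 0 < mu₀ →
        ∃ ρ₀ : ℝ, 0 ≤ ρ₀ ∧ ∀ ρ : ℝ, ρ₀ ≤ ρ →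
          ∀ (lam : ℕ → Fin K → ℝ) (mu : ℕ → ℝ) (m : ℕ → Fin K),
            lam 0 = lam₀ → mu 0 = mu₀ → p.IsHFPI ρ lam mu m →
            (∀ t, lam t ∈ p.hyperplane ∧ 0 < mu t ∧
              ∀ k, 0 < p.rate (lam t) (mu t) k + ρ) ∧
            Filter.Tendsto
              (fun t => Metric.infDist (lam t, mu t)
                {x : (Fin K → ℝ) × ℝ | p.IsKKT Wopt yopt x.1 x.2})
              Filter.atTop (𝓝 0) ∧
            Filter.Tendsto (fun t => p.beam (lam t) (mu t)) Filter.atTop (𝓝 Wopt) ∧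
            Filter.Tendsto (fun t => p.rate (lam t) (mu t) (m t)) Filter.atTop (𝓝 yopt) := by
  -- The statement uses the entrywise topology on matrices; convergence in the Frobenius norm is the
  -- same.
  open scoped Matrix.Norms.Frobenius in
  obtain ⟨ls, ms, ys, hs, hopt, huniq, κ, Wb, yb, hκ, hexc⟩ := hbind.exists_isSaddle hδ hPt
  refine ⟨p.beam ls ms, ys, hopt, huniq, ⟨(ls, ms), RSMA.Problem.isKKT_of_isSaddle hs⟩,
    fun lam₀ hl₀ mu₀ hmu₀ => ?_⟩
  obtain ⟨a, b, ρ₀, ha, hρ₀, H⟩ := hs.exists_run_bounds hκ hexc hl₀ hmu₀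
  refine ⟨ρ₀, hρ₀.le, fun ρ hρ lam mu m hlam hmu hrun => ?_⟩
  have hb := H ρ hρ lam mu m hlam hmu hrun.isRun
  have hmem : ∀ t, lam t ∈ (p.model hδ hPt).simplex ∧ a ≤ mu t := fun t => ⟨(hb t).1, (hb t).2.1⟩
  have hv := hs.tendsto_val ha (hρ₀.trans_le hρ) hrun.worst hb
  have hsol := hs.tendsto_sol ha hmem hv
  refine ⟨fun t => ⟨(hb t).1, ha.trans_le (hb t).2.1, fun k => ((hb t).2.2.2.1 k).1⟩,
    ?_, hsol, hs.tendsto_rate ha hmem hrun.worst hsol⟩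
  refine hs.tendsto_infDist ha (fun t => ⟨(hb t).1, (hb t).2.1, (hb t).2.2.1⟩) hv ?_
  -- Only one inclusion is needed: saddle points with the optimal beamformer are KKT multipliers.
  intro l u h1 h2
  have := RSMA.Problem.isKKT_of_isSaddle h1
  rwa [show p.beam l u = p.beam ls ms from h2] at this
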